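/- Let $B_1$ be the open unit ball of $\mathbb{R}^3$, let $\Omega\subset\mathbb{R}^3$ be a domain diffeomorphic to $B_1$, and let $0\le\alpha<2$. Here a diffeomorphism $\mathcal T:\Omega\to B_1$ is a bijection with $\mathcal T\in C^1(\overline\Omega)$ and $\mathcal T^{-1}\in C^1(\overline{B_1})$, i.e. $\mathcal T$ and $\mathcal T^{-1}$ are $C^1$ and, together with their first derivatives, extend continuously to the closures $\overline\Omega$ and $\overline{B_1}$. For an open set $\Omega$ put $$H(\operatorname{curl},\Omega)=\{u\in[L^2(\Omega)]^3:\nabla\times u\in[L^2(\Omega)]^3\},\qquad H(\operatorname{div},\Omega)=\{u\in[L^2(\Omega)]^3:\operatorname{div}u\in L^2(\Omega)\},$$ with distributional derivatives, the fields being real-valued or complex-valued, and let $d_{\partial\Omega}(x)=\min\{|x-y|:y\in\partial\Omega\}$. Then, for every diffeomorphism $\mathcal T:\Omega\to B_1$, there is a linear operator $$T_1:\{f\in H(\operatorname{div},\Omega):\operatorname{div}f=0\text{ in }\Omega\}\to H(\operatorname{curl},\Omega)$$ such that, for all $f$ in its domain, $$\nabla\times T_1(f)=f\quad\text{in }\Omega\text{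 (in the sense of distributions)},$$ $$\int_\Omega|T_1(f)|^2\,dx\le C\int_\Omega d_{\partial\Omega}^{\,\alpha}\,|f|^2\,dx,$$ where $C>0$ is a constant independent of $f$ (depending only on $\alpha$, $\Omega$ and the choice of $\mathcal T$). Moreover $T_1$ is given by an explicit radial integral: with $\nabla\mathcal T$ the Jacobian matrix of $\mathcal T$ and $$f'(x')=\frac{\nabla\mathcal T(x)\,f(x)}{\det\nabla\mathcal T(x)}\quad\text{for } x'=\mathcal T(x)\in B_1,$$ one has, for almost every $x\in\Omega$, $$T_1(f)(x)=\nabla\mathcal T(x)^{T}F'(\mathcal T(x)),\qquad F'(x')=-\int_0^1 t\,x'\times f'(t x')\,dt,$$ where the integral converges absolutely for almost every $x'=\mathcal T(x)$. -/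

import Mathlib

open MeasureTheory Set
open scoped ContDiff ENNReal

noncomputable section

/-- Physical space `ℝ³` with its Euclidean norm. -/
abbrev E3 : Type := EuclideanSpace ℝ (Fin 3)

/-- The values of the vector fields: `𝕜³` with its Euclidean norm (`𝕜` is `ℝ` or `ℂ`). -/
abbrev V3 (𝕜 : Type*) : Type _ := EuclideanSpace 𝕜 (Fin 3)

/-- `L²(Ω)³`. -/
abbrev L2Field (𝕜 : Type*) [RCLike 𝕜] (Ω : Set E3) : Type _ :=
  Lp (V3 𝕜) 2 (volume.restrict Ω)

/-- `L²(Ω)`. -/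
abbrev L2Scalar (𝕜 : Type*) [RCLike 𝕜] (Ω : Set E3) : Type _ :=
  Lp 𝕜 2 (volume.restrict Ω)

/-- The classical partial derivative `∂ⱼ φ`. -/
def pderiv (j : Fin 3) (φ : E3 → ℝ) (x : E3) : ℝ :=
  fderiv ℝ φ x (EuclideanSpace.single j 1)

/-- The classical curl of a vector field, given by its three components. -/
def testCurl (φ : Fin 3 → E3 → ℝ) (x : E3) : Fin 3 → ℝ :=
  ![pderiv 1 (φ 2) x - pderiv 2 (φ 1) x,
    pderiv 2 (φ 0) x - pderiv 0 (φ 2) x,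
    pderiv 0 (φ 1) x - pderiv 1 (φ 0) x]

/-- `φ ∈ C_c^∞(Ω)`. -/
def IsTest (Ω : Set E3) (φ : E3 → ℝ) : Prop :=
  ContDiff ℝ ∞ φ ∧ HasCompactSupport φ ∧ tsupport φ ⊆ Ω

section Weak

variable {𝕜 : Type*} [RCLike 𝕜]

/-- `div u = g` in `Ω`, in the sense of distributions. -/
def IsWeakDiv (Ω : Set E3) (u : E3 → V3 𝕜) (g : E3 → 𝕜) : Prop :=
  ∀ φ : E3 → ℝ, IsTest Ω φ →
    ∫ x in Ω, (φ x : 𝕜) * g x = - ∫ x in Ω, ∑ i, (pderiv i φ x : 𝕜) * u x i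

/-- `∇ × u = w` in `Ω`, in the sense of distributions. -/
def IsWeakCurl (Ω : Set E3) (u w : E3 → V3 𝕜) : Prop :=
  ∀ φ : Fin 3 → E3 → ℝ, (∀ i, IsTest Ω (φ i)) →
    ∫ x in Ω, ∑ i, (φ i x : 𝕜) * w x i = ∫ x in Ω, ∑ i, (testCurl φ x i : 𝕜) * u x i

theorem IsTest.continuous {Ω : Set E3} {φ : E3 → ℝ} (h : IsTest Ω φ) : Continuous φ :=
  h.1.continuous

theorem IsTest.continuous_pderiv {Ω : Set E3} {φ : E3 → ℝ} (h : IsTest Ω φ) (j : Fin 3) :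
    Continuous (pderiv j φ) :=
  (h.1.continuous_fderiv (by simp)).clm_apply continuous_const

theorem IsTest.hasCompactSupport_pderiv {Ω : Set E3} {φ : E3 → ℝ} (h : IsTest Ω φ)
    (j : Fin 3) : HasCompactSupport (pderiv j φ) :=
  h.2.1.fderiv_apply ℝ _

theorem continuous_testCurl {Ω : Set E3} {φ : Fin 3 → E3 → ℝ} (h : ∀ i, IsTest Ω (φ i))
    (i : Fin 3) : Continuous (fun x => testCurl φ x i) := by
  have := fun i j => (h i).continuous_pderiv j
  fin_cases i <;> simp only [testCurl] <;> exact (this _ _).sub (this _ _)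

theorem hasCompactSupport_testCurl {Ω : Set E3} {φ : Fin 3 → E3 → ℝ}
    (h : ∀ i, IsTest Ω (φ i)) (i : Fin 3) : HasCompactSupport (fun x => testCurl φ x i) := by
  have := fun i j => (h i).hasCompactSupport_pderiv j
  fin_cases i <;> simp only [testCurl] <;> exact (this _ _).sub (this _ _)

theorem integrable_test_mul {Ω : Set E3} {ψ : E3 → ℝ} (hc : Continuous ψ)
    (hs : HasCompactSupport ψ) {g : E3 → 𝕜} (hg : MemLp g 2 (volume.restrict Ω)) :
    Integrable (fun x => (ψ x : 𝕜) * g x) (volume.restrict Ω) := by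
  have h1 : MemLp (fun x => (ψ x : 𝕜)) 2 (volume.restrict Ω) :=
    (hc.memLp_of_hasCompactSupport hs).ofReal
  exact h1.integrable_mul hg

theorem integrable_test_sum {Ω : Set E3} {ψ : Fin 3 → E3 → ℝ} (hc : ∀ i, Continuous (ψ i))
    (hs : ∀ i, HasCompactSupport (ψ i)) (u : L2Field 𝕜 Ω) :
    Integrable (fun x => ∑ i, (ψ i x : 𝕜) * u x i) (volume.restrict Ω) :=
  integrable_finsetSum _ fun i _ => integrable_test_mul (hc i) (hs i)
    ((EuclideanSpace.proj (𝕜 := 𝕜) i).comp_memLp' (Lp.memLp u))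

theorem integral_test_sum_add {Ω : Set E3} {ψ : Fin 3 → E3 → ℝ} (hc : ∀ i, Continuous (ψ i))
    (hs : ∀ i, HasCompactSupport (ψ i)) (u v : L2Field 𝕜 Ω) :
    ∫ x in Ω, ∑ i, (ψ i x : 𝕜) * (u + v : L2Field 𝕜 Ω) x i
      = (∫ x in Ω, ∑ i, (ψ i x : 𝕜) * u x i) + ∫ x in Ω, ∑ i, (ψ i x : 𝕜) * v x i := by
  rw [← integral_add (integrable_test_sum hc hs u) (integrable_test_sum hc hs v)]
  refine integral_congr_ae ?_
  filter_upwards [Lp.coeFn_add u v] with x hx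
  simp only [hx, Pi.add_apply, PiLp.add_apply, mul_add, Finset.sum_add_distrib]

theorem integral_test_sum_smul {Ω : Set E3} (ψ : Fin 3 → E3 → ℝ) (c : 𝕜) (u : L2Field 𝕜 Ω) :
    ∫ x in Ω, ∑ i, (ψ i x : 𝕜) * (c • u : L2Field 𝕜 Ω) x i
      = c * ∫ x in Ω, ∑ i, (ψ i x : 𝕜) * u x i := by
  rw [← integral_const_mul]
  refine integral_congr_ae ?_
  filter_upwards [Lp.coeFn_smul c u] with x hx
  simp [hx, Finset.mul_sum, mul_left_comm]

theorem integral_test_sum_zero {Ω : Set E3} (ψ : Fin 3 → E3 → ℝ) :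
    ∫ x in Ω, ∑ i, (ψ i x : 𝕜) * (0 : L2Field 𝕜 Ω) x i = 0 := by
  rw [← integral_zero E3 𝕜 (μ := volume.restrict Ω)]
  refine integral_congr_ae ?_
  filter_upwards [Lp.coeFn_zero (V3 𝕜) 2 (volume.restrict Ω)] with x hx
  simp only [hx, Pi.zero_apply, PiLp.zero_apply, mul_zero, Finset.sum_const_zero]

variable (𝕜)

/-- `H(curl, Ω) = {u ∈ L²(Ω)³ ; ∇ × u ∈ L²(Ω)³}`. -/
def Hcurl (Ω : Set E3) : Submodule 𝕜 (L2Field 𝕜 Ω) where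
  carrier := {u | ∃ w : L2Field 𝕜 Ω, IsWeakCurl Ω u w}
  zero_mem' := ⟨0, fun φ _ => by
    rw [integral_test_sum_zero φ, integral_test_sum_zero fun i x => testCurl φ x i]⟩
  add_mem' := by
    rintro u v ⟨w, hw⟩ ⟨z, hz⟩
    refine ⟨w + z, fun φ hφ => ?_⟩
    rw [integral_test_sum_add (fun i => (hφ i).continuous) (fun i => (hφ i).2.1),
      integral_test_sum_add (ψ := fun i x => testCurl φ x i) (continuous_testCurl hφ)
        (hasCompactSupport_testCurl hφ), hw φ hφ, hz φ hφ]
  smul_mem' := by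
    rintro c u ⟨w, hw⟩
    refine ⟨c • w, fun φ hφ => ?_⟩
    rw [integral_test_sum_smul φ, integral_test_sum_smul fun i x => testCurl φ x i, hw φ hφ]

/-- `H(div, Ω) = {u ∈ L²(Ω)³ ; div u ∈ L²(Ω)}`. -/
def Hdiv (Ω : Set E3) : Submodule 𝕜 (L2Field 𝕜 Ω) where
  carrier := {u | ∃ g : L2Scalar 𝕜 Ω, IsWeakDiv Ω u g}
  zero_mem' := ⟨0, fun φ _ => by
    rw [integral_test_sum_zero fun i => pderiv i φ, neg_zero,
      ← integral_zero E3 𝕜 (μ := volume.restrict Ω)]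
    refine integral_congr_ae ?_
    filter_upwards [Lp.coeFn_zero 𝕜 2 (volume.restrict Ω)] with x hx
    simp only [hx, Pi.zero_apply, mul_zero]⟩
  add_mem' := by
    rintro u v ⟨g, hg⟩ ⟨k, hk⟩
    refine ⟨g + k, fun φ hφ => ?_⟩
    rw [integral_test_sum_add (ψ := fun i => pderiv i φ) hφ.continuous_pderiv
      hφ.hasCompactSupport_pderiv, neg_add, ← hg φ hφ, ← hk φ hφ, ← integral_add
        (integrable_test_mul hφ.continuous hφ.2.1 (Lp.memLp g))
        (integrable_test_mul hφ.continuous hφ.2.1 (Lp.memLp k))]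
    refine integral_congr_ae ?_
    filter_upwards [Lp.coeFn_add g k] with x hx
    simp only [hx, Pi.add_apply, mul_add]
  smul_mem' := by
    rintro c u ⟨g, hg⟩
    refine ⟨c • g, fun φ hφ => ?_⟩
    rw [integral_test_sum_smul fun i => pderiv i φ, ← mul_neg, ← hg φ hφ,
      ← integral_const_mul]
    refine integral_congr_ae ?_
    filter_upwards [Lp.coeFn_smul c g] with x hx
    simp [hx, mul_left_comm]

/-- `{f ∈ H(div, Ω) ; div f = 0 in Ω}`. -/
def HdivFree (Ω : Set E3) : Submodule 𝕜 (L2Field 𝕜 Ω) where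
  carrier := {f | f ∈ Hdiv 𝕜 Ω ∧ IsWeakDiv Ω f (fun _ => (0 : 𝕜))}
  zero_mem' := ⟨zero_mem _, fun φ _ => by
    rw [integral_test_sum_zero fun i => pderiv i φ]; simp⟩
  add_mem' := by
    rintro u v ⟨hu, hu'⟩ ⟨hv, hv'⟩
    refine ⟨add_mem hu hv, fun φ hφ => ?_⟩
    rw [integral_test_sum_add (ψ := fun i => pderiv i φ) hφ.continuous_pderiv
      hφ.hasCompactSupport_pderiv, neg_add, ← hu' φ hφ, ← hv' φ hφ]
    simp
  smul_mem' := by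
    rintro c u ⟨hu, hu'⟩
    refine ⟨Submodule.smul_mem _ c hu, fun φ hφ => ?_⟩
    rw [integral_test_sum_smul fun i => pderiv i φ, ← mul_neg, ← hu' φ hφ]
    simp

end Weak

/-- `F ∈ C¹(Ω̄)` for an open set `Ω`: `F` is `C¹` in `Ω`, and `F` and its derivative extend
continuously to the closure of `Ω`. -/
def IsC1UpToBoundary (Ω : Set E3) (F : E3 → E3) : Prop :=
  ContDiffOn ℝ 1 F Ω ∧
    (∃ F₀ : E3 → E3, ContinuousOn F₀ (closure Ω) ∧ EqOn F F₀ Ω) ∧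
    (∃ F₁ : E3 → E3 →L[ℝ] E3, ContinuousOn F₁ (closure Ω) ∧ EqOn (fderiv ℝ F) F₁ Ω)

/-- `F : Ω → Ω'` is a diffeomorphism of open sets with inverse `G : Ω' → Ω`, where
`F ∈ C¹(Ω̄)` and `G ∈ C¹(Ω̄')`. The values of `F` off `Ω` and of `G` off `Ω'` play no role. -/
structure IsDiffeo (Ω Ω' : Set E3) (F G : E3 → E3) : Prop where
  mapsTo : MapsTo F Ω Ω'
  mapsTo_inv : MapsTo G Ω' Ω
  invOn : InvOn G F Ω Ω'
  regular : IsC1UpToBoundary Ω F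
  regular_inv : IsC1UpToBoundary Ω' G

/-- The Jacobian matrix `(∂ⱼ Fᵢ(x))ᵢⱼ`. -/
def jac (F : E3 → E3) (x : E3) : Matrix (Fin 3) (Fin 3) ℝ :=
  Matrix.of fun i j => pderiv j (fun y => F y i) x

section Formula

variable {𝕜 : Type*} [RCLike 𝕜]

/-- A real matrix acting on `𝕜³`. -/
def actOn (A : Matrix (Fin 3) (Fin 3) ℝ) (v : V3 𝕜) : V3 𝕜 :=
  WithLp.toLp 2 ((A.map fun a => (a : 𝕜)).mulVec v.ofLp)

/-- The cross product `x × v` of `x ∈ ℝ³` and `v ∈ 𝕜³`. -/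
def crossE (x : E3) (v : V3 𝕜) : V3 𝕜 :=
  WithLp.toLp 2 (crossProduct (fun i => (x i : 𝕜)) v.ofLp)

/-- The transported field `f'(x') = (∇F(x) f(x)) / det ∇F(x)`, where `x = G(x')`. -/
def transported (F G : E3 → E3) (f : E3 → V3 𝕜) (x' : E3) : V3 𝕜 :=
  (((jac F (G x')).det)⁻¹ : ℝ) • actOn (jac F (G x')) (f (G x'))

/-- The integrand `t ↦ t x' × h(t x')` of the radial integral. -/
def radialIntegrand (h : E3 → V3 𝕜) (x' : E3) (t : ℝ) : V3 𝕜 :=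
  t • crossE x' (h (t • x'))

/-- The radial potential `- ∫₀¹ t x' × h(t x') dt`. -/
def radialPotential (h : E3 → V3 𝕜) (x' : E3) : V3 𝕜 :=
  - ∫ t in (0 : ℝ)..1, radialIntegrand h x' t

end Formula

end

/-! On the unit ball the operator is the Poincaré homotopy formula for closed 2-forms, centred at
the origin; a general `Ω` is reduced to the ball by pulling forms back.

Weak curl on the ball. Regard a test field `ψ` as a 1-form. Its dilates `s ψ(s z)` have as
`s`-derivative the value at `s z` of the Lie derivative of `ψ` along the Euler field, which Cartan's
formula splits as `∇(y · ψ) + curl ψ × y` (`radialDeriv_eq`). Paired with a divergence-free `h`, the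
gradient drops out. The substitution `s = 1/t`, `z = t y` turns the rest into the pairing of `curl
ψ` with the radial integrand at `t`. Integrating over `t ∈ (0, 1)` gives `∫ ψ · h = ∫ curl ψ · F'`,
because the boundary term at `t = 0` vanishes for `h ∈ L²` (`norm_dilatedPairing_sq_le`).

Weighted estimate. Cauchy–Schwarz against the kernel `k(t) = t^(-1/2) (1 - t)^(-α/2)`, followed by
`z = t y` and `1 - t ≤ 1 - |z|`, bounds the radial average (`setLIntegral_radialAvg_sq_le`); `k` is
integrable because `α < 2`. The weight `1 - |F x|` is at most a multiple of the distance from `x` to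
`∂Ω` (`IsDiffeo.one_sub_norm_le`).

Transport. The field `f'` is the Piola transform of `f`, so it stays divergence-free, and
multiplication by `∇Fᵀ` pulls 1-forms back, hence commutes with the curl. Since `F` and `G` are only
`C¹`, the pulled-back test form `∑ (φᵢ ∘ G) dGᵢ` is merely continuous. Its curl is nevertheless `∑
∇(φᵢ ∘ G) × ∇Gᵢ`, without second derivatives, so it suffices to prove the ball identity for fields
`a ∇b` with `a`, `b` of class `C¹`, by mollifying `a` and `b` separately
(`integral_pair_cross_grad_radialPotential`).

Elements of `L²` are classes modulo null sets whereas the formula reads values along rays, so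
linearity holds only almost everywhere and is itself deduced from the estimate
(`ae_radialAvg_eq_zero`). -/

open Filter Topology Metric

/-! ### Test functions of class `C¹` -/

/-- A `C¹` function with compact support in `U`. -/
structure IsC1Test (U : Set E3) (φ : E3 → ℝ) : Prop where
  contDiff : ContDiff ℝ 1 φ
  hasCompactSupport : HasCompactSupport φ
  tsupport_subset : tsupport φ ⊆ U

theorem IsTest.isC1Test {U : Set E3} {φ : E3 → ℝ} (h : IsTest U φ) : IsC1Test U φ :=
  ⟨h.1.of_le (by simp), h.2.1, h.2.2⟩

theorem IsC1Test.continuous_pderiv {U : Set E3} {φ : E3 → ℝ} (h : IsC1Test U φ) (j : Fin 3) :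
    Continuous (pderiv j φ) :=
  (h.contDiff.continuous_fderiv one_ne_zero).clm_apply continuous_const

theorem IsC1Test.hasCompactSupport_pderiv {U : Set E3} {φ : E3 → ℝ} (h : IsC1Test U φ)
    (j : Fin 3) : HasCompactSupport (pderiv j φ) :=
  h.hasCompactSupport.fderiv_apply ℝ _

theorem IsC1Test.differentiableAt {U : Set E3} {φ : E3 → ℝ} (h : IsC1Test U φ) (x : E3) :
    DifferentiableAt ℝ φ x :=
  (h.contDiff.differentiable one_ne_zero) x

theorem pderiv_convolution {U : Set E3} {f φ : E3 → ℝ} (hf : LocallyIntegrable f volume)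
    (hφ : IsC1Test U φ) (j : Fin 3) (x : E3) :
    pderiv j (convolution f φ (ContinuousLinearMap.lsmul ℝ ℝ) volume) x
      = convolution f (pderiv j φ) (ContinuousLinearMap.lsmul ℝ ℝ) volume x := by
  rw [pderiv, (hφ.hasCompactSupport.hasFDerivAt_convolution_right
    (ContinuousLinearMap.lsmul ℝ ℝ) hf hφ.contDiff x).fderiv]
  exact convolution_precompR_apply (ContinuousLinearMap.lsmul ℝ ℝ) hf
    (hφ.hasCompactSupport.fderiv ℝ) (hφ.contDiff.continuous_fderiv one_ne_zero) x _

theorem HasCompactSupport.exists_forall_dist_le {g : E3 → ℝ} (hs : HasCompactSupport g)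
    (hc : Continuous g) {ε : ℝ} (hε : 0 < ε) :
    ∃ δ > 0, ∀ x y, dist x y < δ → dist (g x) (g y) ≤ ε := by
  obtain ⟨δ, hδ, h⟩ := Metric.uniformContinuous_iff.1
    (hs.uniformContinuous_of_continuous hc) ε hε
  exact ⟨δ, hδ, fun x y hxy => (h hxy).le⟩

/-- Smooth test functions are dense in the `C¹` test functions. -/
theorem IsC1Test.exists_isTest_near {U : Set E3} (hU : IsOpen U) {φ : E3 → ℝ}
    (hφ : IsC1Test U φ) {ε : ℝ} (hε : 0 < ε) :
    ∃ ψ, IsTest U ψ ∧ ∀ x, |ψ x - φ x| ≤ ε ∧ ∀ j, |pderiv j ψ x - pderiv j φ x| ≤ ε := by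
  obtain ⟨δ₀, hδ₀, h₀⟩ :=
    hφ.hasCompactSupport.exists_forall_dist_le hφ.contDiff.continuous hε
  choose δ₁ hδ₁ h₁ using fun j =>
    (hφ.hasCompactSupport_pderiv j).exists_forall_dist_le (hφ.continuous_pderiv j) hε
  obtain ⟨δ₂, hδ₂, h₂⟩ := hφ.hasCompactSupport.isCompact.exists_cthickening_subset_open hU
    hφ.tsupport_subset
  -- One mollification radius serves three purposes: the moduli of continuity of `φ` and of all its
  -- partial derivatives, and keeping the thickened support inside `U`.
  obtain ⟨r, hr, hr₀, hr₁, hr₂⟩ : ∃ r > 0, r ≤ δ₀ ∧ (∀ j, r ≤ δ₁ j) ∧ r ≤ δ₂ := by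
    refine ⟨min (min δ₀ δ₂) (min (δ₁ 0) (min (δ₁ 1) (δ₁ 2))), by simp [*], ?_, ?_, ?_⟩
    · exact (min_le_left _ _).trans (min_le_left _ _)
    · intro j
      fin_cases j <;> simp
    · exact (min_le_left _ _).trans (min_le_right _ _)
  let b : ContDiffBump (0 : E3) := ⟨r / 2, r, by positivity, by linarith⟩
  have hb : LocallyIntegrable (b.normed volume) volume :=
    b.continuous_normed.locallyIntegrable
  set ψ := convolution (b.normed volume) φ (ContinuousLinearMap.lsmul ℝ ℝ) volume
  have hcs : HasCompactSupport ψ :=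
    HasCompactSupport.convolution _ b.hasCompactSupport_normed hφ.hasCompactSupport
  refine ⟨ψ, ⟨?_, hcs, ?_⟩, fun x => ⟨?_, fun j => ?_⟩⟩
  · exact b.hasCompactSupport_normed.contDiff_convolution_left (n := ⊤) _ b.contDiff_normed
      hφ.contDiff.continuous.locallyIntegrable
  · refine (closure_minimal ?_ isClosed_cthickening).trans h₂
    refine (support_convolution_subset _).trans ?_
    rintro _ ⟨u, hu, v, hv, rfl⟩
    rw [b.support_normed_eq] at hu
    refine mem_cthickening_of_dist_le _ v _ _ (subset_tsupport _ hv) ?_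
    have : ‖u‖ < r := by simpa using hu
    simpa using this.le.trans hr₂
  · rw [← Real.dist_eq]
    exact ContDiffBump.dist_normed_convolution_le
      hφ.contDiff.continuous.aestronglyMeasurable
      fun y hy => h₀ _ _ ((mem_ball.1 hy).trans_le hr₀)
  · rw [pderiv_convolution hb hφ, ← Real.dist_eq]
    exact ContDiffBump.dist_normed_convolution_le
      (hφ.continuous_pderiv j).aestronglyMeasurable
      fun y hy => h₁ j _ _ ((mem_ball.1 hy).trans_le (hr₁ j))

/-! ### The bilinear pairing of real test fields with `𝕜`-valued fields -/

section Pairing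

variable {𝕜 : Type*} [RCLike 𝕜]

/-- The bilinear pairing `∑ pᵢ vᵢ`. -/
noncomputable def pair (p : Fin 3 → ℝ) (v : V3 𝕜) : 𝕜 := ∑ i, (p i : 𝕜) * v i

theorem pair_add_left (p q : Fin 3 → ℝ) (v : V3 𝕜) : pair (p + q) v = pair p v + pair q v := by
  simp [pair, add_mul, Finset.sum_add_distrib]

theorem pair_sub_left (p q : Fin 3 → ℝ) (v : V3 𝕜) : pair (p - q) v = pair p v - pair q v := by
  simp [pair, sub_mul, Finset.sum_sub_distrib]

theorem pair_smul_left (c : ℝ) (p : Fin 3 → ℝ) (v : V3 𝕜) : pair (c • p) v = c • pair p v := by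
  simp [pair, Finset.smul_sum, RCLike.real_smul_eq_coe_mul, mul_assoc]

theorem pair_smul_right (c : ℝ) (p : Fin 3 → ℝ) (v : V3 𝕜) : pair p (c • v) = c • pair p v := by
  simp [pair, Finset.smul_sum, RCLike.real_smul_eq_coe_mul, mul_left_comm]

theorem pair_neg_right (p : Fin 3 → ℝ) (v : V3 𝕜) : pair p (-v) = -pair p v := by
  simp [pair]

@[simp] theorem pair_zero_left (v : V3 𝕜) : pair 0 v = 0 := by simp [pair]

@[simp] theorem pair_zero_right (p : Fin 3 → ℝ) : pair p (0 : V3 𝕜) = 0 := by simp [pair]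

theorem norm_pair_le {p : Fin 3 → ℝ} {c : ℝ} (hp : ∀ i, |p i| ≤ c) (v : V3 𝕜) :
    ‖pair p v‖ ≤ 3 * c * ‖v‖ := by
  have hc : 0 ≤ c := (abs_nonneg _).trans (hp 0)
  calc ‖pair p v‖ ≤ ∑ i : Fin 3, c * ‖v‖ := by
        refine (norm_sum_le _ _).trans (Finset.sum_le_sum fun i _ => ?_)
        rw [norm_mul, RCLike.norm_ofReal]
        exact mul_le_mul (hp i) (PiLp.norm_apply_le v i) (norm_nonneg _) hc
    _ = _ := by simp; ring

/-- `pair p` as a continuous linear map. -/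
noncomputable def pairL (p : Fin 3 → ℝ) : V3 𝕜 →L[𝕜] 𝕜 :=
  ∑ i, (p i : 𝕜) • EuclideanSpace.proj (𝕜 := 𝕜) i

theorem pairL_apply (p : Fin 3 → ℝ) (v : V3 𝕜) : pairL p v = pair p v := by
  simp [pairL, pair]

theorem MeasureTheory.AEStronglyMeasurable.pair {X : Type*} [MeasurableSpace X]
    {μ : Measure X} {p : X → Fin 3 → ℝ} {v : X → V3 𝕜}
    (hp : ∀ i, AEStronglyMeasurable (fun x => p x i) μ) (hv : AEStronglyMeasurable v μ) :
    AEStronglyMeasurable (fun x => pair (p x) (v x)) μ := by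
  unfold _root_.pair
  refine Finset.aestronglyMeasurable_fun_sum _ fun i _ => ?_
  exact (RCLike.continuous_ofReal.comp_aestronglyMeasurable (hp i)).mul
    ((EuclideanSpace.proj (𝕜 := 𝕜) i).continuous.comp_aestronglyMeasurable hv)

theorem MeasureTheory.Integrable.pair {X : Type*} [MeasurableSpace X]
    {μ : Measure X} {p : X → Fin 3 → ℝ} {v : X → V3 𝕜}
    (hp : ∀ i, AEStronglyMeasurable (fun x => p x i) μ) {c : ℝ} (hc : ∀ x i, |p x i| ≤ c)
    (hv : Integrable v μ) : Integrable (fun x => pair (p x) (v x)) μ :=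
  (hv.norm.const_mul (3 * c)).mono' (.pair hp hv.1) (.of_forall fun x => norm_pair_le (hc x) _)

/-- Two pairings against an integrable field are equal if the test fields can be approximated
uniformly by test fields for which they are equal. -/
theorem integral_pair_eq_of_approx {X : Type*} [MeasurableSpace X] {μ : Measure X}
    {u v : X → V3 𝕜} (hu : Integrable u μ) (hv : Integrable v μ) {p q : X → Fin 3 → ℝ} {c : ℝ}
    (hpm : ∀ i, AEStronglyMeasurable (fun x => p x i) μ) (hpc : ∀ x i, |p x i| ≤ c)
    (hqm : ∀ i, AEStronglyMeasurable (fun x => q x i) μ) (hqc : ∀ x i, |q x i| ≤ c)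
    (h : ∀ ε > 0, ∃ p' q' : X → Fin 3 → ℝ,
      (∀ i, AEStronglyMeasurable (fun x => p' x i) μ) ∧
      (∀ i, AEStronglyMeasurable (fun x => q' x i) μ) ∧
      (∀ x i, |p' x i - p x i| ≤ ε) ∧ (∀ x i, |q' x i - q x i| ≤ ε) ∧
      ∫ x, pair (p' x) (u x) ∂μ = ∫ x, pair (q' x) (v x) ∂μ) :
    ∫ x, pair (p x) (u x) ∂μ = ∫ x, pair (q x) (v x) ∂μ := by
  have key : ∀ {p p' : X → Fin 3 → ℝ} {u : X → V3 𝕜} {ε : ℝ}, Integrable u μ →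
      (∀ i, AEStronglyMeasurable (fun x => p x i) μ) → (∀ x i, |p x i| ≤ c) →
      (∀ i, AEStronglyMeasurable (fun x => p' x i) μ) → (∀ x i, |p' x i - p x i| ≤ ε) →
      ‖∫ x, pair (p' x) (u x) ∂μ - ∫ x, pair (p x) (u x) ∂μ‖ ≤ 3 * ε * ∫ x, ‖u x‖ ∂μ := by
    intro p p' u ε hu hpm hpc hpm' hpc'
    have hb : ∀ x i, |p' x i| ≤ c + ε := fun x i => by
      have h1 := abs_add_le (p x i) (p' x i - p x i)
      rw [add_sub_cancel] at h1
      linarith [hpc x i, hpc' x i]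
    rw [← integral_sub (.pair hpm' hb hu) (.pair hpm hpc hu), ← integral_const_mul]
    refine norm_integral_le_of_norm_le (hu.norm.const_mul _) (.of_forall fun x => ?_)
    rw [← pair_sub_left]
    exact norm_pair_le (fun i => hpc' x i) _
  refine eq_of_norm_sub_le_zero (le_of_forall_pos_le_add fun η hη => ?_)
  set A := 3 * (∫ x, ‖u x‖ ∂μ) + 3 * ∫ x, ‖v x‖ ∂μ with hA
  have hA0 : 0 ≤ A := by positivity
  obtain ⟨p', q', hp', hq', hpp, hqq, he⟩ := h (η / (A + 1)) (by positivity)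
  have h1 := key hu hpm hpc hp' hpp
  have h2 := key hv hqm hqc hq' hqq
  rw [he, norm_sub_rev] at h1
  have h3 := norm_sub_le_norm_sub_add_norm_sub (∫ x, pair (p x) (u x) ∂μ)
    (∫ x, pair (q' x) (v x) ∂μ) (∫ x, pair (q x) (v x) ∂μ)
  have h4 : η / (A + 1) * A ≤ η := by
    rw [div_mul_eq_mul_div, div_le_iff₀ (by positivity)]
    nlinarith
  have h5 : 3 * (η / (A + 1)) * (∫ x, ‖u x‖ ∂μ) + 3 * (η / (A + 1)) * (∫ x, ‖v x‖ ∂μ)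
    = η / (A + 1) * A := by rw [hA]; ring
  linarith

end Pairing

/-! ### Gradients of `C¹` test functions against divergence-free fields -/

/-- The gradient of a scalar function. -/
noncomputable def grad (φ : E3 → ℝ) (x : E3) : Fin 3 → ℝ := fun j => pderiv j φ x

theorem IsC1Test.exists_bound {U : Set E3} {φ : E3 → ℝ} (h : IsC1Test U φ) :
    ∃ c, ∀ x, |φ x| ≤ c ∧ ∀ j, |pderiv j φ x| ≤ c := by
  obtain ⟨c, hc⟩ := h.hasCompactSupport.exists_bound_of_continuous h.contDiff.continuous
  choose d hd using fun j =>
    (h.hasCompactSupport_pderiv j).exists_bound_of_continuous (h.continuous_pderiv j)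
  have h0 : ∀ j, 0 ≤ d j := fun j => (norm_nonneg _).trans (hd j 0)
  have h1 : 0 ≤ c := (norm_nonneg _).trans (hc 0)
  refine ⟨c + ∑ j, d j, fun x => ⟨?_, fun j => ?_⟩⟩
  · exact (hc x).trans (le_add_of_nonneg_right (Finset.sum_nonneg fun j _ => h0 j))
  · exact (hd j x).trans ((Finset.single_le_sum (fun j _ => h0 j) (Finset.mem_univ j)).trans
      (le_add_of_nonneg_left h1))

/-- A weakly divergence-free integrable field is orthogonal to gradients of `C¹` test
functions. -/
theorem integral_pair_grad_eq_zero {𝕜 : Type*} [RCLike 𝕜] {U : Set E3} (hU : IsOpen U)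
    {u : E3 → V3 𝕜} (hu : IntegrableOn u U) (hdiv : IsWeakDiv U u (fun _ => (0 : 𝕜)))
    {φ : E3 → ℝ} (hφ : IsC1Test U φ) : ∫ x in U, pair (grad φ x) (u x) = 0 := by
  obtain ⟨c, hc⟩ := hφ.exists_bound
  have hc0 : 0 ≤ c := (abs_nonneg _).trans (hc 0).1
  have h := integral_pair_eq_of_approx (μ := volume.restrict U) (p := grad φ)
    (q := fun _ => 0) (c := c) hu hu
    (fun i => (hφ.continuous_pderiv i).aestronglyMeasurable) (fun x i => (hc x).2 i)
    (fun i => aestronglyMeasurable_const) (fun x i => by simpa using hc0) ?_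
  · simpa using h
  · intro ε hε
    obtain ⟨ψ, hψ, hψε⟩ := hφ.exists_isTest_near hU hε
    refine ⟨grad ψ, fun _ => 0, fun i => (hψ.continuous_pderiv i).aestronglyMeasurable,
      fun i => aestronglyMeasurable_const, fun x i => (hψε x).2 i,
      fun x i => by simpa using hε.le, ?_⟩
    have := hdiv ψ hψ
    simp only [mul_zero, integral_zero, zero_eq_neg] at this
    simpa [pair, grad] using this

/-! ### The weighted estimate for radial averages -/

theorem lintegral_comp_smul_E3 {t : ℝ} (ht : 0 < t) {M : E3 → ℝ≥0∞} (hM : Measurable M) :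
    ∫⁻ y, M (t • y) = ENNReal.ofReal (t ^ 3)⁻¹ * ∫⁻ z, M z := by
  have h := Measure.map_addHaar_smul (volume : Measure E3) ht.ne'
  rw [← lintegral_map hM (measurable_const_smul t), h, lintegral_smul_measure,
    finrank_euclideanSpace_fin, abs_of_pos (by positivity), smul_eq_mul]

theorem integrableOn_rpow_mul_one_sub_rpow {a b : ℝ} (ha : -1 < a) (hb : -1 < b) :
    IntegrableOn (fun t : ℝ => t ^ a * (1 - t) ^ b) (Ioo 0 1) := by
  have h := Complex.betaIntegral_convergent (u := (a + 1 : ℝ)) (v := (b + 1 : ℝ))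
    (by simpa using by linarith) (by simpa using by linarith)
  rw [intervalIntegrable_iff_integrableOn_Ioo_of_le zero_le_one] at h
  refine IntegrableOn.congr_fun (Integrable.norm h) (fun t ht => ?_) measurableSet_Ioo
  have h1 : ((1 : ℂ) - (t : ℂ)) = ((1 - t : ℝ) : ℂ) := by simp
  simp only [norm_mul]
  rw [h1, Complex.norm_cpow_eq_rpow_re_of_pos ht.1,
    Complex.norm_cpow_eq_rpow_re_of_pos (by linarith [ht.2])]
  simp

theorem lintegral_mul_sq_le {X : Type*} [MeasurableSpace X] {μ : Measure X} {f g : X → ℝ≥0∞}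
    (hf : AEMeasurable f μ) (hg : AEMeasurable g μ) :
    (∫⁻ x, f x * g x ∂μ) ^ 2 ≤ (∫⁻ x, f x ^ 2 ∂μ) * ∫⁻ x, g x ^ 2 ∂μ := by
  have h := ENNReal.lintegral_mul_le_Lp_mul_Lq μ (p := 2) (q := 2)
    (Real.holderConjugate_iff.2 (by norm_num)) hf hg
  simp only [Pi.mul_apply, ENNReal.rpow_two] at h
  calc _ ≤ _ := pow_le_pow_left' h 2
    _ = _ := by
      rw [mul_pow, ← ENNReal.rpow_natCast, ← ENNReal.rpow_natCast, ← ENNReal.rpow_mul,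
        ← ENNReal.rpow_mul]
      norm_num

/-- The kernel `t^(-1/2) (1 - t)^(-α/2)`. -/
noncomputable def betaKernel (α t : ℝ) : ℝ := t ^ (-(1 / 2) : ℝ) * (1 - t) ^ (-(α / 2))

theorem measurable_betaKernel (α : ℝ) : Measurable (betaKernel α) := by
  unfold betaKernel; fun_prop

theorem betaKernel_pos (α : ℝ) {t : ℝ} (ht : t ∈ Ioo (0 : ℝ) 1) : 0 < betaKernel α t :=
  mul_pos (Real.rpow_pos_of_pos ht.1 _) (Real.rpow_pos_of_pos (by linarith [ht.2]) _)

/-- This fixes the exponents of the kernel `k`: it amounts to `t²/k = k t³ (1 - t)^α`, where `t³`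
cancels the Jacobian of `y ↦ t y` and `(1 - t)^α` supplies the weight. Both factors of
Cauchy–Schwarz are then governed by `∫ k`. -/
theorem betaKernel_sq (α : ℝ) {t : ℝ} (ht : t ∈ Ioo (0 : ℝ) 1) :
    betaKernel α t ^ 2 = t⁻¹ * ((1 - t) ^ α)⁻¹ := by
  have h1 : 0 < 1 - t := by linarith [ht.2]
  rw [betaKernel, mul_pow, ← Real.rpow_natCast, ← Real.rpow_natCast, ← Real.rpow_mul ht.1.le,
    ← Real.rpow_mul h1.le, ← Real.rpow_neg h1.le, ← Real.rpow_neg_one]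
  norm_num

/-- The condition `α < 2` enters the estimate here: the exponent `-α/2` must exceed `-1`. -/
theorem lintegral_betaKernel_lt_top {α : ℝ} (hα : α < 2) :
    ∫⁻ t in Ioo (0 : ℝ) 1, ENNReal.ofReal (betaKernel α t) < ⊤ :=
  (integrableOn_rpow_mul_one_sub_rpow (a := -(1 / 2)) (b := -(α / 2)) (by norm_num)
    (by linarith)).lintegral_lt_top

/-- The radial average `∫₀¹ t N(t y) dt`. -/
noncomputable def radialAvg (N : E3 → ℝ≥0∞) (y : E3) : ℝ≥0∞ :=
  ∫⁻ t in Ioo (0 : ℝ) 1, ENNReal.ofReal t * N (t • y)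

theorem measurable_radialAvg_integrand {N : E3 → ℝ≥0∞} (hN : Measurable N) :
    Measurable fun p : E3 × ℝ => ENNReal.ofReal p.2 * N (p.2 • p.1) := by
  have : Measurable fun p : E3 × ℝ => p.2 • p.1 := measurable_snd.smul measurable_fst
  exact measurable_snd.ennreal_ofReal.mul (hN.comp this)

theorem measurable_radialAvg {N : E3 → ℝ≥0∞} (hN : Measurable N) : Measurable (radialAvg N) :=
  (measurable_radialAvg_integrand hN).lintegral_prod_right'

/-- For `|y| < 1` one has `|t y| ≤ t`, so `(1 - t)^α` is bounded by the weight at `t y`;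
substituting `z = t y` then costs `t⁻³`. -/
theorem setLIntegral_ball_sq_comp_smul_le {α : ℝ} (hα : 0 ≤ α) {N : E3 → ℝ≥0∞}
    (hN : Measurable N) {t : ℝ} (ht : t ∈ Ioo (0 : ℝ) 1) :
    ENNReal.ofReal (t ^ 2 / betaKernel α t) * ∫⁻ y in ball (0 : E3) 1, N (t • y) ^ 2
      ≤ ENNReal.ofReal (betaKernel α t) *
        ∫⁻ z in ball (0 : E3) 1, ENNReal.ofReal ((1 - ‖z‖) ^ α) * N z ^ 2 := by
  have hNt : Measurable fun y : E3 => N (t • y) ^ 2 :=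
    (hN.comp (measurable_const_smul t)).pow_const 2
  set M : E3 → ℝ≥0∞ :=
    (ball (0 : E3) 1).indicator fun z => ENNReal.ofReal ((1 - ‖z‖) ^ α) * N z ^ 2 with hM
  have hMm : Measurable M := by
    refine Measurable.indicator ?_ measurableSet_ball
    exact Measurable.mul (by fun_prop) (hN.pow_const 2)
  have ht1 : 0 < 1 - t := by linarith [ht.2]
  have hpos : 0 < (1 - t) ^ α := Real.rpow_pos_of_pos ht1 _
  have hle : ∀ y ∈ ball (0 : E3) 1,
      ENNReal.ofReal ((1 - t) ^ α) * N (t • y) ^ 2 ≤ M (t • y) := by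
    intro y hy
    have hy1 : ‖y‖ < 1 := by simpa using hy
    have hty : ‖t • y‖ ≤ t := by
      rw [norm_smul, Real.norm_of_nonneg ht.1.le]
      exact mul_le_of_le_one_right ht.1.le hy1.le
    rw [hM, indicator_of_mem (by simpa using hty.trans_lt ht.2)]
    gcongr
  have h1 : ENNReal.ofReal ((1 - t) ^ α) * ∫⁻ y in ball (0 : E3) 1, N (t • y) ^ 2
      ≤ ENNReal.ofReal (t ^ 3)⁻¹ * ∫⁻ z, M z := by
    rw [← lintegral_const_mul _ hNt, ← lintegral_comp_smul_E3 ht.1 hMm]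
    exact (setLIntegral_mono' measurableSet_ball hle).trans (setLIntegral_le_lintegral _ _)
  have hk := betaKernel_pos α ht
  have h2 : t ^ 2 / betaKernel α t = betaKernel α t * t ^ 3 * (1 - t) ^ α := by
    rw [div_eq_iff hk.ne']
    have := betaKernel_sq α ht
    calc t ^ 2 = (t⁻¹ * ((1 - t) ^ α)⁻¹) * t ^ 3 * (1 - t) ^ α := by
          have := ht.1.ne'
          field_simp
      _ = _ := by rw [← this]; ring
  have ht3 : 0 < t ^ 3 := pow_pos ht.1 3
  rw [h2, ENNReal.ofReal_mul (by positivity), ENNReal.ofReal_mul hk.le, mul_assoc, mul_assoc]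
  gcongr
  refine (mul_le_mul_right h1 _).trans_eq ?_
  rw [← mul_assoc, ← ENNReal.ofReal_mul ht3.le, mul_inv_cancel₀ ht3.ne', ENNReal.ofReal_one,
    one_mul, hM, lintegral_indicator measurableSet_ball]

/-- The weighted `L²` estimate for the radial average on the unit ball. -/
theorem setLIntegral_radialAvg_sq_le {α : ℝ} (hα : 0 ≤ α) {N : E3 → ℝ≥0∞}
    (hN : Measurable N) :
    ∫⁻ y in ball (0 : E3) 1, radialAvg N y ^ 2
      ≤ (∫⁻ t in Ioo (0 : ℝ) 1, ENNReal.ofReal (betaKernel α t)) ^ 2 *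
        ∫⁻ z in ball (0 : E3) 1, ENNReal.ofReal ((1 - ‖z‖) ^ α) * N z ^ 2 := by
  set K := ∫⁻ t in Ioo (0 : ℝ) 1, ENNReal.ofReal (betaKernel α t) with hK
  set A := ∫⁻ z in ball (0 : E3) 1, ENNReal.ofReal ((1 - ‖z‖) ^ α) * N z ^ 2
  have hkm := measurable_betaKernel α
  have hNs : Measurable fun p : E3 × ℝ => N (p.2 • p.1) ^ 2 :=
    (hN.comp (measurable_snd.smul measurable_fst)).pow_const 2
  have h1 : ∀ y, radialAvg N y ^ 2
      ≤ K * ∫⁻ t in Ioo (0 : ℝ) 1,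
        ENNReal.ofReal (t ^ 2 / betaKernel α t) * N (t • y) ^ 2 := by
    intro y
    have hNy : Measurable fun t : ℝ => N (t • y) :=
      hN.comp (measurable_id.smul measurable_const)
    -- Cauchy–Schwarz for the splitting `t N = √k · (t/√k) N`.
    have h := lintegral_mul_sq_le (μ := volume.restrict (Ioo (0 : ℝ) 1))
      (f := fun t => ENNReal.ofReal (√(betaKernel α t)))
      (g := fun t => ENNReal.ofReal (t / √(betaKernel α t)) * N (t • y))
      (by fun_prop) (Measurable.aemeasurable (Measurable.mul (by fun_prop) hNy))
    refine (le_of_eq ?_).trans (h.trans (le_of_eq ?_))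
    · rw [radialAvg]
      congr 1
      refine setLIntegral_congr_fun measurableSet_Ioo fun t ht => ?_
      have hk := Real.sqrt_pos.2 (betaKernel_pos α ht)
      rw [← mul_assoc, ← ENNReal.ofReal_mul hk.le, mul_div_cancel₀ _ hk.ne']
    · congr 1
      · refine setLIntegral_congr_fun measurableSet_Ioo fun t ht => ?_
        rw [← ENNReal.ofReal_pow (Real.sqrt_nonneg _), Real.sq_sqrt (betaKernel_pos α ht).le]
      · refine setLIntegral_congr_fun measurableSet_Ioo fun t ht => ?_
        rw [mul_pow, ← ENNReal.ofReal_pow (div_nonneg ht.1.le (Real.sqrt_nonneg _)), div_pow,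
          Real.sq_sqrt (betaKernel_pos α ht).le]
  have hm : Measurable fun p : E3 × ℝ =>
      ENNReal.ofReal (p.2 ^ 2 / betaKernel α p.2) * N (p.2 • p.1) ^ 2 := by
    refine Measurable.mul ?_ hNs
    exact ((measurable_snd.pow_const 2).div (hkm.comp measurable_snd)).ennreal_ofReal
  calc ∫⁻ y in ball (0 : E3) 1, radialAvg N y ^ 2
      ≤ ∫⁻ y in ball (0 : E3) 1, K * ∫⁻ t in Ioo (0 : ℝ) 1,
          ENNReal.ofReal (t ^ 2 / betaKernel α t) * N (t • y) ^ 2 := lintegral_mono h1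
    _ = K * ∫⁻ t in Ioo (0 : ℝ) 1, ∫⁻ y in ball (0 : E3) 1,
          ENNReal.ofReal (t ^ 2 / betaKernel α t) * N (t • y) ^ 2 := by
        rw [lintegral_const_mul _ hm.lintegral_prod_right',
          lintegral_lintegral_swap hm.aemeasurable]
    _ ≤ K * ∫⁻ t in Ioo (0 : ℝ) 1, ENNReal.ofReal (betaKernel α t) * A := by
        refine mul_le_mul_right (setLIntegral_mono' measurableSet_Ioo fun t ht => ?_) _
        have hNt : Measurable fun y : E3 => N (t • y) ^ 2 :=
          (hN.comp (measurable_const_smul t)).pow_const 2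
        rw [lintegral_const_mul _ hNt]
        exact setLIntegral_ball_sq_comp_smul_le hα hN ht
    _ = K ^ 2 * A := by
        rw [lintegral_mul_const _ hkm.ennreal_ofReal, ← hK]; ring

/-! ### The radial potential on the unit ball -/

section RadialPotential

variable {𝕜 : Type*} [RCLike 𝕜]

theorem EuclideanSpace.norm_le_of_forall_le {v : V3 𝕜} {c : ℝ} (h : ∀ i, ‖v i‖ ≤ c) :
    ‖v‖ ≤ 3 * c := by
  have hc : 0 ≤ c := (norm_nonneg _).trans (h 0)
  rw [EuclideanSpace.norm_eq]
  refine Real.sqrt_le_iff.2 ⟨by positivity, ?_⟩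
  calc ∑ i, ‖v i‖ ^ 2 ≤ ∑ _i : Fin 3, c ^ 2 := Finset.sum_le_sum fun i _ =>
        pow_le_pow_left₀ (norm_nonneg _) (h i) 2
    _ ≤ (3 * c) ^ 2 := by simp; nlinarith [sq_nonneg c]

theorem crossE_apply (x : E3) (v : V3 𝕜) (i : Fin 3) :
    crossE x v i = ![(x 1 : 𝕜) * v 2 - x 2 * v 1, x 2 * v 0 - x 0 * v 2,
      x 0 * v 1 - x 1 * v 0] i := by
  simp [crossE, cross_apply]

theorem norm_crossE_le (x : E3) (v : V3 𝕜) : ‖crossE x v‖ ≤ 6 * (‖x‖ * ‖v‖) := by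
  have key : ∀ i j k l, ‖(x i : 𝕜) * v j - x k * v l‖ ≤ 2 * (‖x‖ * ‖v‖) := fun i j k l => by
    have hb : ∀ i j, ‖(x i : 𝕜) * v j‖ ≤ ‖x‖ * ‖v‖ := fun i j => by
      rw [norm_mul, RCLike.norm_ofReal]
      exact mul_le_mul (PiLp.norm_apply_le x i) (PiLp.norm_apply_le v j) (norm_nonneg _)
        (norm_nonneg _)
    linarith [norm_sub_le ((x i : 𝕜) * v j) (x k * v l), hb i j, hb k l]
  refine (EuclideanSpace.norm_le_of_forall_le (c := 2 * (‖x‖ * ‖v‖)) fun i => ?_).trans_eq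
    (by ring)
  rw [crossE_apply]
  fin_cases i <;> exact key _ _ _ _

theorem continuous_crossE : Continuous fun p : E3 × V3 𝕜 => crossE p.1 p.2 := by
  refine (PiLp.continuous_toLp 2 _).comp (continuous_pi fun i => ?_)
  simp only [cross_apply]
  have h1 : ∀ i, Continuous fun p : E3 × V3 𝕜 => ((p.1 i : ℝ) : 𝕜) := fun i =>
    RCLike.continuous_ofReal.comp (by fun_prop)
  have h2 : ∀ i, Continuous fun p : E3 × V3 𝕜 => p.2.ofLp i := fun i => by fun_prop
  fin_cases i <;> exact ((h1 _).mul (h2 _)).sub ((h1 _).mul (h2 _))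

/-- Cyclic invariance of the triple product; it moves the cross product from the field to the test
side. -/
theorem pair_crossE (w : Fin 3 → ℝ) (x : E3) (v : V3 𝕜) :
    pair w (crossE x v) = pair (crossProduct w x.ofLp) v := by
  simp only [pair, crossE_apply, cross_apply, Fin.sum_univ_three]
  simp
  ring

variable {h : E3 → V3 𝕜}

theorem norm_radialIntegrand_le {y : E3} (hy : y ∈ ball (0 : E3) 1) {t : ℝ} (ht : 0 ≤ t) :
    ‖radialIntegrand h y t‖ ≤ 6 * (t * ‖h (t • y)‖) := by
  have hy1 : ‖y‖ ≤ 1 := by simpa using (mem_ball.1 hy).le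
  rw [radialIntegrand, norm_smul, Real.norm_of_nonneg ht]
  have h1 := norm_crossE_le y (h (t • y))
  have h2 : ‖y‖ * ‖h (t • y)‖ ≤ ‖h (t • y)‖ := mul_le_of_le_one_left (norm_nonneg _) hy1
  have h3 := mul_le_mul_of_nonneg_left (h1.trans (mul_le_mul_of_nonneg_left h2 (by norm_num))) ht
  linarith

theorem enorm_radialIntegrand_le {y : E3} (hy : y ∈ ball (0 : E3) 1) {t : ℝ} (ht : 0 ≤ t) :
    ‖radialIntegrand h y t‖ₑ ≤ 6 * (ENNReal.ofReal t * ‖h (t • y)‖ₑ) := by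
  have h1 := ENNReal.ofReal_le_ofReal (norm_radialIntegrand_le (h := h) hy ht)
  rwa [ofReal_norm, ENNReal.ofReal_mul (by norm_num), ENNReal.ofReal_mul ht,
    ofReal_norm, ENNReal.ofReal_ofNat] at h1

theorem stronglyMeasurable_radialIntegrand (hm : StronglyMeasurable h) :
    StronglyMeasurable fun p : E3 × ℝ => radialIntegrand h p.1 p.2 := by
  have h1 : StronglyMeasurable fun p : E3 × ℝ => h (p.2 • p.1) :=
    hm.comp_measurable (measurable_snd.smul measurable_fst)
  have h2 : StronglyMeasurable fun p : E3 × ℝ => crossE p.1 (h (p.2 • p.1)) :=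
    continuous_crossE.comp_stronglyMeasurable
      ((measurable_fst.stronglyMeasurable).prodMk h1)
  exact measurable_snd.stronglyMeasurable.smul h2

theorem stronglyMeasurable_radialPotential (hm : StronglyMeasurable h) :
    StronglyMeasurable (radialPotential h) := by
  have : radialPotential h = fun y => -∫ t in Ioc (0 : ℝ) 1, radialIntegrand h y t := by
    ext1 y
    rw [radialPotential, intervalIntegral.integral_of_le zero_le_one]
  rw [this]
  exact (stronglyMeasurable_radialIntegrand hm).integral_prod_right'.neg

theorem setLIntegral_enorm_radialIntegrand_le {y : E3} (hy : y ∈ ball (0 : E3) 1) :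
    ∫⁻ t in Ioo (0 : ℝ) 1, ‖radialIntegrand h y t‖ₑ ≤ 6 * radialAvg (fun z => ‖h z‖ₑ) y := by
  rw [radialAvg, ← lintegral_const_mul' _ _ (by simp)]
  exact setLIntegral_mono' measurableSet_Ioo fun t ht => enorm_radialIntegrand_le hy ht.1.le

theorem intervalIntegrable_radialIntegrand (hm : StronglyMeasurable h) {y : E3}
    (hy : y ∈ ball (0 : E3) 1) (hfin : radialAvg (fun z => ‖h z‖ₑ) y < ⊤) :
    IntervalIntegrable (radialIntegrand h y) volume 0 1 := by
  rw [intervalIntegrable_iff_integrableOn_Ioo_of_le zero_le_one]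
  refine ⟨((stronglyMeasurable_radialIntegrand hm).comp_measurable
    measurable_prodMk_left).aestronglyMeasurable, ?_⟩
  exact (setLIntegral_enorm_radialIntegrand_le hy).trans_lt
    (ENNReal.mul_lt_top (by simp) hfin)

theorem enorm_radialPotential_le {y : E3} (hy : y ∈ ball (0 : E3) 1) :
    ‖radialPotential h y‖ₑ ≤ 6 * radialAvg (fun z => ‖h z‖ₑ) y := by
  rw [radialPotential, enorm_neg, intervalIntegral.integral_of_le zero_le_one,
    integral_Ioc_eq_integral_Ioo]
  exact (enorm_integral_le_lintegral_enorm _).trans (setLIntegral_enorm_radialIntegrand_le hy)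

/-- The case `α = 0` of the weighted estimate, where the weight is `1`. -/
theorem setLIntegral_radialAvg_sq_lt_top (hm : StronglyMeasurable h)
    (hL : MemLp h 2 volume) :
    ∫⁻ y in ball (0 : E3) 1, radialAvg (fun z => ‖h z‖ₑ) y ^ 2 < ⊤ := by
  refine (setLIntegral_radialAvg_sq_le (α := 0) le_rfl hm.enorm).trans_lt ?_
  refine ENNReal.mul_lt_top (ENNReal.pow_lt_top (lintegral_betaKernel_lt_top (by norm_num))) ?_
  simp only [Real.rpow_zero, ENNReal.ofReal_one, one_mul]
  refine (setLIntegral_le_lintegral _ _).trans_lt ?_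
  have := lintegral_rpow_enorm_lt_top_of_eLpNorm_lt_top (by norm_num) (by norm_num) hL.2
  simpa using this

theorem ae_radialAvg_lt_top (hm : StronglyMeasurable h) (hL : MemLp h 2 volume) :
    ∀ᵐ y ∂volume.restrict (ball (0 : E3) 1), radialAvg (fun z => ‖h z‖ₑ) y < ⊤ := by
  filter_upwards [ae_lt_top ((measurable_radialAvg hm.enorm).pow_const 2)
    (setLIntegral_radialAvg_sq_lt_top hm hL).ne] with y hy
  exact (ENNReal.pow_lt_top_iff.1 hy).resolve_right two_ne_zero

theorem setLIntegral_radialAvg_lt_top (hm : StronglyMeasurable h) (hL : MemLp h 2 volume) :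
    ∫⁻ y in ball (0 : E3) 1, radialAvg (fun z => ‖h z‖ₑ) y < ⊤ := by
  -- Square integrability implies integrability because the ball has finite volume.
  have h1 : ∀ a : ℝ≥0∞, a ≤ 1 + a ^ 2 := fun a => by
    rcases le_total a 1 with ha | ha
    · exact ha.trans le_self_add
    · exact (le_self_pow₀ ha two_ne_zero).trans le_add_self
  refine (lintegral_mono fun y => h1 _).trans_lt ?_
  rw [lintegral_add_left measurable_const]
  refine ENNReal.add_lt_top.2 ⟨?_, setLIntegral_radialAvg_sq_lt_top hm hL⟩
  simp

theorem memLp_radialPotential (hm : StronglyMeasurable h) (hL : MemLp h 2 volume) :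
    MemLp (radialPotential h) 2 (volume.restrict (ball (0 : E3) 1)) := by
  refine ⟨(stronglyMeasurable_radialPotential hm).aestronglyMeasurable, ?_⟩
  rw [eLpNorm_lt_top_iff_lintegral_rpow_enorm_lt_top (by norm_num) (by norm_num)]
  simp only [ENNReal.toReal_ofNat, ENNReal.rpow_two]
  refine (setLIntegral_mono' measurableSet_ball fun y hy =>
    pow_le_pow_left' (enorm_radialPotential_le hy) 2).trans_lt ?_
  simp only [mul_pow]
  rw [lintegral_const_mul' _ _ (by simp)]
  exact ENNReal.mul_lt_top (by simp) (setLIntegral_radialAvg_sq_lt_top hm hL)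

end RadialPotential

/-! ### Operations on test functions -/

theorem IsTest.add {U : Set E3} {φ ψ : E3 → ℝ} (hφ : IsTest U φ) (hψ : IsTest U ψ) :
    IsTest U fun x => φ x + ψ x :=
  ⟨hφ.1.add hψ.1, hφ.2.1.add hψ.2.1,
    (tsupport_add φ ψ).trans (union_subset hφ.2.2 hψ.2.2)⟩

theorem IsTest.mul_left {U : Set E3} {φ g : E3 → ℝ} (hφ : IsTest U φ) (hg : ContDiff ℝ ∞ g) :
    IsTest U fun x => g x * φ x :=
  ⟨hg.mul hφ.1, hφ.2.1.mul_left, (tsupport_mul_subset_right).trans hφ.2.2⟩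

/-- The ball is star-shaped about the origin, and a factor `s ≥ 1` contracts the support towards it.
-/
theorem IsTest.comp_smul {φ : E3 → ℝ} (hφ : IsTest (ball (0 : E3) 1) φ) {s : ℝ} (hs : 1 ≤ s) :
    IsTest (ball (0 : E3) 1) fun x => φ (s • x) := by
  have hs0 : s ≠ 0 := by positivity
  refine ⟨hφ.1.comp (contDiff_const_smul s), hφ.2.1.comp_homeomorph (Homeomorph.smulOfNeZero s hs0),
    fun x hx => ?_⟩
  have h1 : s • x ∈ tsupport φ :=
    tsupport_comp_subset_preimage φ (continuous_const_smul s) hx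
  have h2 := hφ.2.2 h1
  rw [mem_ball_zero_iff, norm_smul, Real.norm_of_nonneg (by positivity)] at h2
  rw [mem_ball_zero_iff]
  nlinarith [norm_nonneg x]

theorem contDiff_coord (i : Fin 3) : ContDiff ℝ ∞ fun x : E3 => x i :=
  (EuclideanSpace.proj (𝕜 := ℝ) i).contDiff

theorem clm_apply_eq_sum (L : E3 →L[ℝ] ℝ) (v : E3) :
    L v = ∑ j, v j * L (EuclideanSpace.single j 1) := by
  have h := (EuclideanSpace.basisFun (Fin 3) ℝ).sum_repr v
  conv_lhs => rw [← h]
  simp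

theorem fderiv_apply_eq_sum (φ : E3 → ℝ) (x v : E3) :
    fderiv ℝ φ x v = ∑ j, v j * pderiv j φ x :=
  clm_apply_eq_sum _ v

theorem pderiv_mul {φ ψ : E3 → ℝ} {x : E3} (hφ : DifferentiableAt ℝ φ x)
    (hψ : DifferentiableAt ℝ ψ x) (j : Fin 3) :
    pderiv j (fun y => φ y * ψ y) x = φ x * pderiv j ψ x + ψ x * pderiv j φ x := by
  simp [pderiv, fderiv_fun_mul hφ hψ]

theorem pderiv_add {φ ψ : E3 → ℝ} {x : E3} (hφ : DifferentiableAt ℝ φ x)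
    (hψ : DifferentiableAt ℝ ψ x) (j : Fin 3) :
    pderiv j (fun y => φ y + ψ y) x = pderiv j φ x + pderiv j ψ x := by
  simp [pderiv, fderiv_fun_add hφ hψ]

theorem pderiv_coord (i j : Fin 3) (x : E3) :
    pderiv j (fun y : E3 => y i) x = if i = j then 1 else 0 := by
  have : HasFDerivAt (fun y : E3 => y i) (EuclideanSpace.proj (𝕜 := ℝ) i) x :=
    (EuclideanSpace.proj (𝕜 := ℝ) i).hasFDerivAt
  rw [pderiv, this.fderiv]
  simp

theorem IsTest.differentiableAt {U : Set E3} {φ : E3 → ℝ} (h : IsTest U φ) (x : E3) :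
    DifferentiableAt ℝ φ x := h.isC1Test.differentiableAt x

theorem pderiv_comp_smul {φ : E3 → ℝ} (s : ℝ) (x : E3) (hφ : DifferentiableAt ℝ φ (s • x))
    (j : Fin 3) : pderiv j (fun y => φ (s • y)) x = s * pderiv j φ (s • x) := by
  have h1 : HasFDerivAt (fun y : E3 => s • y) (s • ContinuousLinearMap.id ℝ E3) x :=
    (hasFDerivAt_id x).const_smul s
  have h2 := hφ.hasFDerivAt.comp x h1
  rw [pderiv, show (fun y => φ (s • y)) = φ ∘ fun y => s • y from rfl, h2.fderiv]
  simp [pderiv]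

/-- The radial contraction `∑ yᵢ ψᵢ(y)`. -/
noncomputable def radialContraction (ψ : Fin 3 → E3 → ℝ) (y : E3) : ℝ :=
  y 0 * ψ 0 y + y 1 * ψ 1 y + y 2 * ψ 2 y

/-- The derivative of `s ↦ s ψ(s z)` at `s` is the value at `s z` of this field. -/
noncomputable def radialDeriv (ψ : Fin 3 → E3 → ℝ) (y : E3) : Fin 3 → ℝ :=
  fun i => ψ i y + fderiv ℝ (ψ i) y y

section

variable {U : Set E3} {ψ : Fin 3 → E3 → ℝ}

theorem isTest_radialContraction (hψ : ∀ i, IsTest U (ψ i)) : IsTest U (radialContraction ψ) :=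
  (((hψ 0).mul_left (contDiff_coord 0)).add ((hψ 1).mul_left (contDiff_coord 1))).add
    ((hψ 2).mul_left (contDiff_coord 2))

theorem pderiv_radialContraction (hψ : ∀ i, IsTest U (ψ i)) (j : Fin 3) (y : E3) :
    pderiv j (radialContraction ψ) y
      = ψ j y + ∑ i, y i * pderiv j (ψ i) y := by
  have hc : ∀ i, DifferentiableAt ℝ (fun y : E3 => y i) y := fun i =>
    ((contDiff_coord i).differentiable (by simp)) y
  have hd : ∀ i, DifferentiableAt ℝ (ψ i) y := fun i => (hψ i).differentiableAt y
  have hm : ∀ i, DifferentiableAt ℝ (fun y : E3 => y i * ψ i y) y := fun i =>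
    (hc i).fun_mul (hd i)
  unfold radialContraction
  rw [pderiv_add ((hm 0).fun_add (hm 1)) (hm 2), pderiv_add (hm 0) (hm 1),
    pderiv_mul (hc 0) (hd 0), pderiv_mul (hc 1) (hd 1), pderiv_mul (hc 2) (hd 2)]
  simp only [pderiv_coord, Fin.sum_univ_three]
  fin_cases j <;> simp <;> ring

/-- Cartan's formula for the Lie derivative of the 1-form `ψ` along the Euler field `y`: exterior
derivative of the contraction, plus contraction of the exterior derivative. -/
theorem radialDeriv_eq (hψ : ∀ i, IsTest U (ψ i)) (y : E3) :
    radialDeriv ψ y = grad (radialContraction ψ) y + crossProduct (testCurl ψ y) y.ofLp := by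
  ext i
  simp only [radialDeriv, grad, Pi.add_apply, pderiv_radialContraction hψ, fderiv_apply_eq_sum,
    cross_apply, testCurl, Fin.sum_univ_three]
  fin_cases i <;> simp <;> ring

theorem continuous_radialDeriv (hψ : ∀ i, IsTest U (ψ i)) (i : Fin 3) :
    Continuous fun y => radialDeriv ψ y i :=
  (hψ i).continuous.add (((hψ i).1.continuous_fderiv (by simp)).clm_apply continuous_id)

theorem exists_bound_radialDeriv (hψ : ∀ i, IsTest U (ψ i)) :
    ∃ c, ∀ y i, |radialDeriv ψ y i| ≤ c := by
  have h1 : ∀ i, HasCompactSupport fun y => radialDeriv ψ y i := fun i =>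
    (hψ i).2.1.mono' (by
      intro y hy
      by_contra hn
      refine hy ?_
      have h0 : fderiv ℝ (ψ i) y = 0 := by
        by_contra h
        exact hn (support_fderiv_subset ℝ h)
      simp [radialDeriv, h0, image_eq_zero_of_notMem_tsupport hn])
  choose c hc using fun i => (h1 i).exists_bound_of_continuous (continuous_radialDeriv hψ i)
  refine ⟨∑ i, c i, fun y i => (hc i y).trans ?_⟩
  exact Finset.single_le_sum (fun j _ => (norm_nonneg _).trans (hc j 0)) (Finset.mem_univ i)

theorem exists_bound_test (hψ : ∀ i, IsTest U (ψ i)) : ∃ c, ∀ y i, |ψ i y| ≤ c := by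
  choose c hc using fun i => (hψ i).2.1.exists_bound_of_continuous (hψ i).continuous
  refine ⟨∑ i, c i, fun y i => (hc i y).trans ?_⟩
  exact Finset.single_le_sum (fun j _ => (norm_nonneg _).trans (hc j 0)) (Finset.mem_univ i)

theorem exists_bound_testCurl (hψ : ∀ i, IsTest U (ψ i)) :
    ∃ c, ∀ y i, |testCurl ψ y i| ≤ c := by
  choose c hc using fun i =>
    (hasCompactSupport_testCurl hψ i).exists_bound_of_continuous (continuous_testCurl hψ i)
  refine ⟨∑ i, c i, fun y i => (hc i y).trans ?_⟩
  exact Finset.single_le_sum (fun j _ => (norm_nonneg _).trans (hc j 0)) (Finset.mem_univ i)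

theorem hasDerivAt_smul_comp_smul (hψ : ∀ i, IsTest U (ψ i)) (z : E3) (s : ℝ) (i : Fin 3) :
    HasDerivAt (fun s : ℝ => s * ψ i (s • z)) (radialDeriv ψ (s • z) i) s := by
  have h1 : HasDerivAt (fun s : ℝ => s • z) z s := by
    simpa using (hasDerivAt_id s).smul_const z
  have h2 := ((hψ i).differentiableAt (s • z)).hasFDerivAt.comp_hasDerivAt s h1
  have h3 := (hasDerivAt_id s).mul h2
  refine h3.congr_deriv ?_
  simp [radialDeriv]

end

/-! ### The weak curl of the radial potential -/

section WeakCurl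

variable {𝕜 : Type*} [RCLike 𝕜] {h : E3 → V3 𝕜} {ψ : Fin 3 → E3 → ℝ}

/-- The pairing of `h` with the dilated test field `s ψ(s ·)`. -/
noncomputable def dilatedPairing (h : E3 → V3 𝕜) (ψ : Fin 3 → E3 → ℝ) (s : ℝ) : 𝕜 :=
  ∫ z, pair (fun i => s * ψ i (s • z)) (h z)

theorem hasDerivAt_dilatedPairing (hψ : ∀ i, IsTest (ball (0 : E3) 1) (ψ i))
    (hi : Integrable h volume) (s : ℝ) :
    HasDerivAt (dilatedPairing h ψ) (∫ z, pair (radialDeriv ψ (s • z)) (h z)) s := by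
  obtain ⟨c, hc⟩ := exists_bound_radialDeriv hψ
  obtain ⟨d, hd⟩ := exists_bound_test hψ
  have hmeas : ∀ s i, AEStronglyMeasurable (fun z => s * ψ i (s • z)) (volume : Measure E3) :=
    fun s i => (continuous_const.mul ((hψ i).continuous.comp
      (continuous_const_smul s))).aestronglyMeasurable
  refine (hasDerivAt_integral_of_dominated_loc_of_deriv_le (s := univ)
    (F := fun s z => pair (fun i => s * ψ i (s • z)) (h z))
    (F' := fun s z => pair (radialDeriv ψ (s • z)) (h z))
    (bound := fun z => 3 * c * ‖h z‖) univ_mem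
    (.of_forall fun s => .pair (hmeas s) hi.1) ?_ ?_ ?_ (hi.norm.const_mul _) ?_).2
  · refine .pair (hmeas s) (c := |s| * d) (fun z i => ?_) hi
    rw [abs_mul]
    exact mul_le_mul_of_nonneg_left (hd _ _) (abs_nonneg s)
  · exact .pair (fun i => ((continuous_radialDeriv hψ i).comp
      (continuous_const_smul s)).aestronglyMeasurable) hi.1
  · exact .of_forall fun z s _ => norm_pair_le (hc _) _
  · refine .of_forall fun z s _ => ?_
    unfold pair
    refine HasDerivAt.fun_sum fun i _ => ?_
    exact ((RCLike.ofRealCLM (K := 𝕜)).hasFDerivAt.comp_hasDerivAt s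
      (hasDerivAt_smul_comp_smul hψ z s i)).mul_const _

/-- The gradient term of Cartan's formula, taken at `s z`, is `1/s` times the gradient of `z ↦ Ψ(s
z)`, with `Ψ` the radial contraction. For `s ≥ 1` this is still a test function on the ball, so the
divergence-free field annihilates it. -/
theorem hasDerivAt_dilatedPairing_of_div_free (hψ : ∀ i, IsTest (ball (0 : E3) 1) (ψ i))
    (hi : Integrable h volume) (h0 : ∀ z ∉ ball (0 : E3) 1, h z = 0)
    (hdiv : IsWeakDiv (ball (0 : E3) 1) h (fun _ => (0 : 𝕜))) {s : ℝ} (hs : 1 ≤ s) :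
    HasDerivAt (dilatedPairing h ψ)
      (∫ z, pair (testCurl ψ (s • z)) (crossE (s • z) (h z))) s := by
  convert hasDerivAt_dilatedPairing hψ hi s using 1
  have hs0 : s ≠ 0 := by positivity
  have hΨ := isTest_radialContraction hψ
  have hg : ∫ z, pair (grad (radialContraction ψ) (s • z)) (h z) = 0 := by
    have h1 := hdiv _ (hΨ.comp_smul hs)
    simp only [mul_zero, integral_zero, zero_eq_neg,
      pderiv_comp_smul s _ (hΨ.differentiableAt _)] at h1
    have h2 : ∀ z, ∑ i, ((s * pderiv i (radialContraction ψ) (s • z) : ℝ) : 𝕜) * h z i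
        = s • pair (grad (radialContraction ψ) (s • z)) (h z) := fun z => by
      rw [← pair_smul_left]; rfl
    simp only [h2] at h1
    rw [integral_smul, smul_eq_zero_iff_right hs0] at h1
    rw [← h1, setIntegral_eq_integral_of_forall_compl_eq_zero]
    intro z hz
    simp [h0 z hz]
  obtain ⟨c, hc⟩ := hΨ.isC1Test.exists_bound
  obtain ⟨d, hd⟩ := exists_bound_radialDeriv hψ
  have hgi : Integrable (fun z => pair (grad (radialContraction ψ) (s • z)) (h z)) :=
    .pair (fun i => ((hΨ.continuous_pderiv i).comp
      (continuous_const_smul s)).aestronglyMeasurable) (fun z => (hc _).2) hi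
  have hri : Integrable (fun z => pair (radialDeriv ψ (s • z)) (h z)) :=
    .pair (fun i => ((continuous_radialDeriv hψ i).comp
      (continuous_const_smul s)).aestronglyMeasurable) (fun z => hd _) hi
  rw [← sub_zero (∫ z, pair (radialDeriv ψ (s • z)) (h z)), ← hg, ← integral_sub hri hgi]
  congr 1
  ext z
  rw [radialDeriv_eq hψ, pair_add_left, add_sub_cancel_left, pair_crossE]

/-- The pairing of a test field with the radial integrand at `t`. -/
noncomputable def radialPairing (h : E3 → V3 𝕜) (w : E3 → Fin 3 → ℝ) (t : ℝ) : 𝕜 :=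
  ∫ y, pair (w y) (radialIntegrand h y t)

/-- Substitution `z = t y`: the Jacobian `t³`, less the factor `t` already present in the radial
integrand, leaves `t²`. -/
theorem integral_pair_crossE_eq_radialPairing (w : E3 → Fin 3 → ℝ) {t : ℝ} (ht : 0 < t) :
    ∫ z, pair (w (t⁻¹ • z)) (crossE (t⁻¹ • z) (h z)) = t ^ 2 • radialPairing h w t := by
  have h1 : ∀ y, pair (w y) (radialIntegrand h y t)
      = t • pair (w (t⁻¹ • t • y)) (crossE (t⁻¹ • t • y) (h (t • y))) := fun y => by
    rw [radialIntegrand, pair_smul_right, inv_smul_smul₀ ht.ne']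
  rw [radialPairing]
  simp only [h1]
  rw [integral_smul, Measure.integral_comp_smul volume
    (fun z => pair (w (t⁻¹ • z)) (crossE (t⁻¹ • z) (h z))) t, finrank_euclideanSpace_fin,
    abs_of_pos (by positivity), smul_smul, smul_smul]
  rw [show t ^ 2 * t * (t ^ 3)⁻¹ = 1 by field_simp, one_smul]

/-- The factor `-t⁻²` from differentiating `s = 1/t` cancels the `t²` of the change of variables. -/
theorem hasDerivAt_dilatedPairing_inv (hψ : ∀ i, IsTest (ball (0 : E3) 1) (ψ i))
    (hi : Integrable h volume) (h0 : ∀ z ∉ ball (0 : E3) 1, h z = 0)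
    (hdiv : IsWeakDiv (ball (0 : E3) 1) h (fun _ => (0 : 𝕜))) {t : ℝ} (ht : 0 < t)
    (ht1 : t ≤ 1) :
    HasDerivAt (fun t => dilatedPairing h ψ t⁻¹) (-radialPairing h (testCurl ψ) t) t := by
  have h1 := hasDerivAt_dilatedPairing_of_div_free hψ hi h0 hdiv ((one_le_inv₀ ht).2 ht1)
  have h2 := h1.scomp t (hasDerivAt_inv ht.ne')
  rw [integral_pair_crossE_eq_radialPairing _ ht, smul_smul] at h2
  refine h2.congr_deriv ?_
  rw [show -(t ^ 2)⁻¹ * t ^ 2 = (-1 : ℝ) by field_simp, neg_one_smul]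

/-- The pairing decays like `s^(-1/2)`: the dilated field has size `s` and lives on a ball of volume
of order `s⁻³`, which Cauchy–Schwarz against `h ∈ L²` turns into `s · s^(-3/2)`. Writing `s = a²`
avoids fractional powers. -/
theorem norm_dilatedPairing_sq_le (hψ : ∀ i, IsTest (ball (0 : E3) 1) (ψ i))
    (hi2 : Integrable (fun z => ‖h z‖ ^ 2) volume) :
    ∃ C, ∀ a : ℝ, 0 < a → ‖dilatedPairing h ψ (a ^ 2)‖ ≤ C * a⁻¹ := by
  obtain ⟨c, hc⟩ := exists_bound_test hψ
  have hc0 : 0 ≤ c := (abs_nonneg _).trans (hc 0 0)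
  refine ⟨3 * c * (volume.real (ball (0 : E3) 1) + ∫ z, ‖h z‖ ^ 2), fun a ha => ?_⟩
  have ha2 : 0 < a ^ 2 := by positivity
  have hb : ∀ z, ‖pair (fun i => a ^ 2 * ψ i (a ^ 2 • z)) (h z)‖
      ≤ 3 * c * ((ball (0 : E3) (a ^ 2)⁻¹).indicator (fun _ => a ^ 5) z + a⁻¹ * ‖h z‖ ^ 2) := by
    intro z
    by_cases hz : z ∈ ball (0 : E3) (a ^ 2)⁻¹
    · have h1 : ‖pair (fun i => a ^ 2 * ψ i (a ^ 2 • z)) (h z)‖ ≤ 3 * (a ^ 2 * c) * ‖h z‖ :=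
        norm_pair_le (fun i => by
          rw [abs_mul, abs_of_pos ha2]
          exact mul_le_mul_of_nonneg_left (hc _ _) ha2.le) _
      -- A weighted Young inequality, balanced so that `a⁵` times the volume of the ball of radius
      -- `a⁻²` is again of order `a⁻¹`.
      have h2 : a ^ 2 * ‖h z‖ ≤ a ^ 5 + a⁻¹ * ‖h z‖ ^ 2 := by
        rw [← sub_nonneg]
        have : a ^ 5 + a⁻¹ * ‖h z‖ ^ 2 - a ^ 2 * ‖h z‖
            = a⁻¹ * ((a ^ 3 - ‖h z‖ / 2) ^ 2 + 3 / 4 * ‖h z‖ ^ 2) := by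
          field_simp; ring
        rw [this]; positivity
      rw [indicator_of_mem hz]
      calc _ ≤ _ := h1
        _ = 3 * c * (a ^ 2 * ‖h z‖) := by ring
        _ ≤ _ := mul_le_mul_of_nonneg_left h2 (by positivity)
    · have h1 : ∀ i, ψ i (a ^ 2 • z) = 0 := fun i => by
        refine image_eq_zero_of_notMem_tsupport fun hn => hz ?_
        have h2 := (hψ i).2.2 hn
        rw [mem_ball_zero_iff, norm_smul, Real.norm_of_nonneg ha2.le] at h2
        rwa [mem_ball_zero_iff, ← one_div, lt_div_iff₀' ha2]
      have h3 : pair (fun i => a ^ 2 * ψ i (a ^ 2 • z)) (h z) = 0 := by simp [pair, h1]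
      rw [h3, norm_zero, indicator_of_notMem hz]
      positivity
  have hint : Integrable fun z : E3 =>
      (ball (0 : E3) (a ^ 2)⁻¹).indicator (fun _ => a ^ 5) z :=
    (integrableOn_const measure_ball_lt_top.ne).integrable_indicator measurableSet_ball
  refine (norm_integral_le_of_norm_le ((hint.add (hi2.const_mul a⁻¹)).const_mul (3 * c))
    (.of_forall hb)).trans_eq ?_
  simp only [Pi.add_apply]
  rw [integral_const_mul, integral_add hint (hi2.const_mul a⁻¹), integral_const_mul,
    integral_indicator measurableSet_ball, setIntegral_const, measureReal_def,
    Measure.addHaar_ball_of_pos _ _ (by positivity : 0 < (a ^ 2)⁻¹), finrank_euclideanSpace_fin,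
    ENNReal.toReal_mul, ENNReal.toReal_ofReal (by positivity), smul_eq_mul, measureReal_def]
  field_simp

theorem tendsto_dilatedPairing_inv (hψ : ∀ i, IsTest (ball (0 : E3) 1) (ψ i))
    (hi2 : Integrable (fun z => ‖h z‖ ^ 2) volume) :
    Tendsto (fun t => dilatedPairing h ψ t⁻¹) (𝓝[>] 0) (𝓝 0) := by
  obtain ⟨C, hC⟩ := norm_dilatedPairing_sq_le hψ hi2
  refine squeeze_zero_norm' (a := fun t => C * √t) ?_ ?_
  · filter_upwards [self_mem_nhdsWithin] with t ht
    have h1 := hC (√t)⁻¹ (inv_pos.2 (Real.sqrt_pos.2 ht))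
    rwa [inv_pow, Real.sq_sqrt (le_of_lt ht), inv_inv] at h1
  · have : Tendsto (fun t => C * √t) (𝓝 0) (𝓝 (C * √0)) :=
      (continuous_const.mul Real.continuous_sqrt).tendsto 0
    rw [Real.sqrt_zero, mul_zero] at this
    exact this.mono_left nhdsWithin_le_nhds

/-- Integrability on the product justifies exchanging the spatial and the radial integral. -/
theorem integrable_pair_radialIntegrand (hm : StronglyMeasurable h) (hL : MemLp h 2 volume)
    {w : E3 → Fin 3 → ℝ} (hw : ∀ i, Measurable fun y => w y i) {c : ℝ}
    (hc : ∀ y i, |w y i| ≤ c) :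
    Integrable (fun p : E3 × ℝ => pair (w p.1) (radialIntegrand h p.1 p.2))
      ((volume.restrict (ball (0 : E3) 1)).prod (volume.restrict (Ioo (0 : ℝ) 1))) := by
  refine Integrable.pair (fun i => ((hw i).comp measurable_fst).aestronglyMeasurable)
    (fun p => hc p.1) ⟨(stronglyMeasurable_radialIntegrand hm).aestronglyMeasurable, ?_⟩
  rw [HasFiniteIntegral, lintegral_prod _
    (stronglyMeasurable_radialIntegrand hm).enorm.aemeasurable]
  refine (setLIntegral_mono' measurableSet_ball fun y hy =>
    setLIntegral_enorm_radialIntegrand_le hy).trans_lt ?_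
  rw [lintegral_const_mul' _ _ (by simp)]
  exact ENNReal.mul_lt_top (by simp) (setLIntegral_radialAvg_lt_top hm hL)

theorem pair_integral {X : Type*} [MeasurableSpace X] {μ : Measure X} (p : Fin 3 → ℝ)
    {v : X → V3 𝕜} (hv : Integrable v μ) : pair p (∫ x, v x ∂μ) = ∫ x, pair p (v x) ∂μ := by
  simp only [← pairL_apply]
  exact ((pairL p).integral_comp_comm hv).symm

/-- Against smooth test fields, the curl of the radial potential of a divergence-free field on
the unit ball is that field. -/
theorem integral_pair_radialPotential_testCurl (hm : StronglyMeasurable h)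
    (hL : MemLp h 2 volume) (h0 : ∀ z ∉ ball (0 : E3) 1, h z = 0)
    (hdiv : IsWeakDiv (ball (0 : E3) 1) h (fun _ => (0 : 𝕜)))
    (hψ : ∀ i, IsTest (ball (0 : E3) 1) (ψ i)) :
    ∫ y in ball (0 : E3) 1, pair (fun i => ψ i y) (h y)
      = ∫ y in ball (0 : E3) 1, pair (testCurl ψ y) (radialPotential h y) := by
  have hi : Integrable h volume := by
    rw [← integrableOn_iff_integrable_of_support_subset
      (s := ball (0 : E3) 1) fun z hz => not_not.1 fun hn => hz (h0 z hn)]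
    have : IsFiniteMeasure (volume.restrict (ball (0 : E3) 1)) :=
      ⟨by simp⟩
    exact (hL.restrict _).integrable (by norm_num)
  have hi2 : Integrable (fun z => ‖h z‖ ^ 2) volume := hL.integrable_norm_pow two_ne_zero
  obtain ⟨c, hc⟩ := exists_bound_testCurl hψ
  have hw := continuous_testCurl hψ
  have hprod := integrable_pair_radialIntegrand hm hL (fun i => (hw i).measurable) hc
  have hE : ∀ t, ∫ y in ball (0 : E3) 1, pair (testCurl ψ y) (radialIntegrand h y t)
      = radialPairing h (testCurl ψ) t := fun t => by
    refine setIntegral_eq_integral_of_forall_compl_eq_zero fun y hy => ?_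
    have h1 : ∀ i j, pderiv j (ψ i) y = 0 := fun i j =>
      image_eq_zero_of_notMem_tsupport (f := pderiv j (ψ i)) fun hn =>
        hy ((hψ i).2.2 (closure_minimal (fun z hz => by
          by_contra h'
          refine hz ?_
          have : fderiv ℝ (ψ i) z = 0 := by
            by_contra h2
            exact h' (support_fderiv_subset ℝ h2)
          simp [pderiv, this]) (isClosed_tsupport _) hn))
    have h2 : testCurl ψ y = 0 := by
      ext i
      fin_cases i <;> simp [testCurl, h1]
    rw [h2, pair_zero_left]
  have hEi : IntervalIntegrable (fun t => -radialPairing h (testCurl ψ) t) volume 0 1 := by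
    rw [intervalIntegrable_iff_integrableOn_Ioo_of_le zero_le_one]
    have h1 := hprod.integral_prod_right
    simp only [hE] at h1
    exact h1.neg
  -- Fundamental theorem of calculus on `(0, 1)`: the limit at `0` vanishes by the decay of the
  -- dilated pairing, and the value at `1` is the undilated pairing of `ψ` with `h`.
  have hF := intervalIntegral.integral_eq_sub_of_hasDerivAt_of_tendsto (zero_lt_one)
    (fun t ht => hasDerivAt_dilatedPairing_inv hψ hi h0 hdiv ht.1 ht.2.le) hEi
    (tendsto_dilatedPairing_inv hψ hi2)
    ((hasDerivAt_dilatedPairing_inv hψ hi h0 hdiv zero_lt_one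
      le_rfl).continuousAt.tendsto.mono_left nhdsWithin_le_nhds)
  have h1 : ∫ y in ball (0 : E3) 1, pair (fun i => ψ i y) (h y)
      = dilatedPairing h ψ (1 : ℝ)⁻¹ := by
    rw [setIntegral_eq_integral_of_forall_compl_eq_zero fun y hy => by simp [h0 y hy]]
    simp [dilatedPairing]
  rw [h1, ← sub_zero (dilatedPairing h ψ _), ← hF, intervalIntegral.integral_neg,
    intervalIntegral.integral_of_le zero_le_one, integral_Ioc_eq_integral_Ioo]
  simp only [← hE]
  rw [← integral_integral_swap hprod, ← integral_neg]
  refine integral_congr_ae ?_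
  filter_upwards [ae_radialAvg_lt_top hm hL, ae_restrict_mem measurableSet_ball] with y hy hy1
  have h2 := intervalIntegrable_radialIntegrand hm hy1 hy
  rw [intervalIntegrable_iff_integrableOn_Ioo_of_le zero_le_one] at h2
  rw [radialPotential, pair_neg_right, intervalIntegral.integral_of_le zero_le_one,
    integral_Ioc_eq_integral_Ioo, pair_integral _ h2]

end WeakCurl

/-! ### Test fields of the form `a ∇b` -/

theorem pderiv_comm {φ : E3 → ℝ} (hφ : ContDiff ℝ ∞ φ) (i j : Fin 3) (x : E3) :
    pderiv i (pderiv j φ) x = pderiv j (pderiv i φ) x := by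
  have h1 : DifferentiableAt ℝ (fderiv ℝ φ) x :=
    ((hφ.fderiv_right (m := 1) (by rw [one_add_one_eq_two]; exact ENat.LEInfty.out)).differentiable one_ne_zero) x
  have h2 : ∀ i j, pderiv i (pderiv j φ) x
      = fderiv ℝ (fderiv ℝ φ) x (EuclideanSpace.single i 1) (EuclideanSpace.single j 1) := by
    intro i j
    have h3 : HasFDerivAt (pderiv j φ)
        ((ContinuousLinearMap.apply ℝ ℝ (EuclideanSpace.single j 1)).comp
          (fderiv ℝ (fderiv ℝ φ) x)) x :=
      ((ContinuousLinearMap.apply ℝ ℝ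
        (EuclideanSpace.single j 1 : E3)).hasFDerivAt (x := fderiv ℝ φ x)).comp x h1.hasFDerivAt
    rw [pderiv, h3.fderiv]
    rfl
  rw [h2, h2]
  exact (hφ.contDiffAt.isSymmSndFDerivAt (by simpa using ENat.LEInfty.out)) _ _

theorem IsTest.pderiv {U : Set E3} {φ : E3 → ℝ} (hφ : IsTest U φ) (j : Fin 3) :
    IsTest U (pderiv j φ) := by
  refine ⟨?_, hφ.hasCompactSupport_pderiv j, ?_⟩
  · exact (hφ.1.fderiv_right (m := ∞) (by simp)).clm_apply contDiff_const
  · refine (closure_minimal (fun z hz => ?_) (isClosed_tsupport _)).trans hφ.2.2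
    by_contra h'
    refine hz ?_
    have : fderiv ℝ φ z = 0 := by
      by_contra h2
      exact h' (support_fderiv_subset ℝ h2)
    simp [_root_.pderiv, this]

/-- The second derivatives of `b` cancel by symmetry. The right-hand side involves first derivatives
only, so it passes to limits in `C¹`. -/
theorem testCurl_mul_grad {U : Set E3} {a b : E3 → ℝ} (ha : IsTest U a) (hb : IsTest U b)
    (y : E3) :
    testCurl (fun i z => a z * pderiv i b z) y = crossProduct (grad a y) (grad b y) := by
  have h : ∀ i j, pderiv j (fun z => a z * pderiv i b z) y
      = a y * pderiv j (pderiv i b) y + pderiv i b y * pderiv j a y := fun i j =>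
    pderiv_mul (ha.differentiableAt y) ((hb.pderiv i).differentiableAt y) j
  ext i
  simp only [testCurl, h, cross_apply, grad]
  rw [pderiv_comm hb.1 2 1, pderiv_comm hb.1 2 0, pderiv_comm hb.1 1 0]
  fin_cases i <;> simp <;> ring

theorem abs_mul_sub_mul_le {a b a' b' c δ : ℝ} (ha : |a| ≤ c) (hb : |b| ≤ c)
    (ha' : |a' - a| ≤ δ) (hb' : |b' - b| ≤ δ) (hδ : δ ≤ 1) :
    |a' * b' - a * b| ≤ δ * (2 * c + 1) := by
  have hc : 0 ≤ c := (abs_nonneg _).trans ha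
  have hδ0 : 0 ≤ δ := (abs_nonneg _).trans ha'
  have h1 : a' * b' - a * b = (a' - a) * (b' - b) + (a' - a) * b + a * (b' - b) := by ring
  rw [h1]
  refine (abs_add_three _ _ _).trans ?_
  simp only [abs_mul]
  have h2 := mul_le_mul ha' hb' (abs_nonneg _) hδ0
  have h3 := mul_le_mul ha' hb (abs_nonneg _) hδ0
  have h4 := mul_le_mul ha hb' (abs_nonneg _) hc
  nlinarith

theorem abs_cross_sub_cross_le {p q p' q' : Fin 3 → ℝ} {c δ : ℝ} (hp : ∀ i, |p i| ≤ c)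
    (hq : ∀ i, |q i| ≤ c) (hp' : ∀ i, |p' i - p i| ≤ δ) (hq' : ∀ i, |q' i - q i| ≤ δ)
    (hδ : δ ≤ 1) (i : Fin 3) :
    |crossProduct p' q' i - crossProduct p q i| ≤ 2 * (δ * (2 * c + 1)) := by
  have key : ∀ i j k l, |(p' i * q' j - p' k * q' l) - (p i * q j - p k * q l)|
      ≤ 2 * (δ * (2 * c + 1)) := fun i j k l => by
    have h1 := abs_mul_sub_mul_le (hp i) (hq j) (hp' i) (hq' j) hδ
    have h2 := abs_mul_sub_mul_le (hp k) (hq l) (hp' k) (hq' l) hδ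
    rw [abs_le] at h1 h2 ⊢
    constructor <;> linarith [h1.1, h1.2, h2.1, h2.2]
  simp only [cross_apply]
  fin_cases i <;> exact key _ _ _ _

theorem abs_cross_le {p q : Fin 3 → ℝ} {c : ℝ} (hp : ∀ i, |p i| ≤ c) (hq : ∀ i, |q i| ≤ c)
    (i : Fin 3) : |crossProduct p q i| ≤ 2 * c ^ 2 := by
  have hc : 0 ≤ c := (abs_nonneg _).trans (hp 0)
  have key : ∀ i j k l, |p i * q j - p k * q l| ≤ 2 * c ^ 2 := fun i j k l => by
    refine (abs_sub _ _).trans ?_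
    rw [abs_mul, abs_mul]
    nlinarith [mul_le_mul (hp i) (hq j) (abs_nonneg _) hc,
      mul_le_mul (hp k) (hq l) (abs_nonneg _) hc]
  simp only [cross_apply]
  fin_cases i <;> exact key _ _ _ _

theorem continuous_cross_apply {p q : E3 → Fin 3 → ℝ} (hp : ∀ i, Continuous fun y => p y i)
    (hq : ∀ i, Continuous fun y => q y i) (i : Fin 3) :
    Continuous fun y => crossProduct (p y) (q y) i := by
  simp only [cross_apply]
  fin_cases i <;> exact ((hp _).mul (hq _)).sub ((hp _).mul (hq _))

section

variable {𝕜 : Type*} [RCLike 𝕜] {h : E3 → V3 𝕜}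

theorem MemLp.integrableOn_ball {f : E3 → V3 𝕜}
    (hf : MemLp f 2 (volume.restrict (ball (0 : E3) 1))) : IntegrableOn f (ball (0 : E3) 1) := by
  have : IsFiniteMeasure (volume.restrict (ball (0 : E3) 1)) := ⟨by simp⟩
  exact hf.integrable (by norm_num)

/-- The curl identity for the radial potential, tested against `a ∇b` with `a` and `b` of
class `C¹`. -/
theorem integral_pair_cross_grad_radialPotential (hm : StronglyMeasurable h)
    (hL : MemLp h 2 volume) (h0 : ∀ z ∉ ball (0 : E3) 1, h z = 0)
    (hdiv : IsWeakDiv (ball (0 : E3) 1) h (fun _ => (0 : 𝕜))) {a b : E3 → ℝ}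
    (ha : IsC1Test (ball (0 : E3) 1) a) (hb : IsC1Test (ball (0 : E3) 1) b) :
    ∫ y in ball (0 : E3) 1, pair (a y • grad b y) (h y)
      = ∫ y in ball (0 : E3) 1,
        pair (crossProduct (grad a y) (grad b y)) (radialPotential h y) := by
  obtain ⟨ca, hca⟩ := ha.exists_bound
  obtain ⟨cb, hcb⟩ := hb.exists_bound
  set c := max ca cb
  have hca' : ∀ x, |a x| ≤ c ∧ ∀ j, |grad a x j| ≤ c := fun x =>
    ⟨(hca x).1.trans (le_max_left _ _), fun j => ((hca x).2 j).trans (le_max_left _ _)⟩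
  have hcb' : ∀ x j, |grad b x j| ≤ c := fun x j => ((hcb x).2 j).trans (le_max_right _ _)
  have hc0 : 0 ≤ c := (abs_nonneg _).trans (hca' 0).1
  refine integral_pair_eq_of_approx (c := 2 * c ^ 2)
    (MemLp.integrableOn_ball (hL.restrict _))
    (MemLp.integrableOn_ball (memLp_radialPotential hm hL))
    (fun i => (ha.contDiff.continuous.mul (hb.continuous_pderiv i)).aestronglyMeasurable)
    (fun x i => ?_)
    (fun i => (continuous_cross_apply ha.continuous_pderiv
      hb.continuous_pderiv i).aestronglyMeasurable)
    (fun x i => abs_cross_le (hca' x).2 (hcb' x) i) fun ε hε => ?_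
  · rw [Pi.smul_apply, smul_eq_mul, abs_mul]
    nlinarith [mul_le_mul (hca' x).1 (hcb' x i) (abs_nonneg _) hc0, sq_nonneg c]
  -- The cap `1` lets `δ²` be absorbed into `δ` in the product estimate; the factor `2` counts the
  -- two products in each component of a cross product.
  · set δ := min 1 (ε / (2 * (2 * c + 1)))
    have hδ : 0 < δ := lt_min one_pos (by positivity)
    have hδε : 2 * (δ * (2 * c + 1)) ≤ ε := by
      have h1 : δ ≤ ε / (2 * (2 * c + 1)) := min_le_right _ _
      rw [le_div_iff₀ (by positivity)] at h1
      linarith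
    obtain ⟨a', ha', haa⟩ := ha.exists_isTest_near isOpen_ball hδ
    obtain ⟨b', hb', hbb⟩ := hb.exists_isTest_near isOpen_ball hδ
    refine ⟨fun y => a' y • grad b' y, fun y => crossProduct (grad a' y) (grad b' y),
      fun i => (ha'.continuous.mul (hb'.continuous_pderiv i)).aestronglyMeasurable,
      fun i => (continuous_cross_apply ha'.continuous_pderiv
        hb'.continuous_pderiv i).aestronglyMeasurable, fun x i => ?_, fun x i => ?_, ?_⟩
    · have := abs_mul_sub_mul_le (hca' x).1 (hcb' x i) (haa x).1 ((hbb x).2 i)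
        (min_le_left _ _)
      have h2 : 0 ≤ δ * (2 * c + 1) := by positivity
      exact this.trans (by linarith)
    · exact (abs_cross_sub_cross_le (hca' x).2 (hcb' x) (haa x).2 (hbb x).2
        (min_le_left _ _) i).trans hδε
    · have hψ : ∀ i, IsTest (ball (0 : E3) 1) (fun z => a' z * pderiv i b' z) := fun i =>
        (hb'.pderiv i).mul_left ha'.1
      have := integral_pair_radialPotential_testCurl hm hL h0 hdiv hψ
      simp only [testCurl_mul_grad ha' hb'] at this
      exact this

end

/-! ### Diffeomorphisms up to the boundary -/

theorem IsC1UpToBoundary.differentiableAt {Ω : Set E3} (hΩ : IsOpen Ω) {F : E3 → E3}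
    (hF : IsC1UpToBoundary Ω F) {x : E3} (hx : x ∈ Ω) : DifferentiableAt ℝ F x :=
  (hF.1.differentiableOn one_ne_zero x hx).differentiableAt (hΩ.mem_nhds hx)

theorem IsC1UpToBoundary.continuousOn_fderiv {Ω : Set E3} (hΩ : IsOpen Ω) {F : E3 → E3}
    (hF : IsC1UpToBoundary Ω F) : ContinuousOn (fderiv ℝ F) Ω :=
  hF.1.continuousOn_fderiv_of_isOpen hΩ le_rfl

theorem IsC1UpToBoundary.exists_norm_fderiv_le {Ω : Set E3} {F : E3 → E3}
    (hF : IsC1UpToBoundary Ω F) (hb : Bornology.IsBounded Ω) :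
    ∃ M, 0 < M ∧ ∀ x ∈ Ω, ‖fderiv ℝ F x‖ ≤ M := by
  obtain ⟨F₁, hc, he⟩ := hF.2.2
  obtain ⟨M, hM⟩ := hb.isCompact_closure.exists_bound_of_continuousOn hc
  refine ⟨max M 1, by simp, fun x hx => ?_⟩
  rw [he hx]
  exact (hM x (subset_closure hx)).trans (le_max_left _ _)

theorem IsC1UpToBoundary.isBounded_image {Ω : Set E3} {F : E3 → E3}
    (hF : IsC1UpToBoundary Ω F) (hb : Bornology.IsBounded Ω) : Bornology.IsBounded (F '' Ω) := by
  obtain ⟨F₀, hc, he⟩ := hF.2.1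
  rw [he.image_eq]
  exact (hb.isCompact_closure.image_of_continuousOn hc).isBounded.subset
    (image_mono subset_closure)

namespace IsDiffeo

variable {Ω Ω' : Set E3} {F G : E3 → E3}

theorem symm (h : IsDiffeo Ω Ω' F G) : IsDiffeo Ω' Ω G F :=
  ⟨h.mapsTo_inv, h.mapsTo, h.invOn.symm, h.regular_inv, h.regular⟩

theorem left_inv (h : IsDiffeo Ω Ω' F G) {x : E3} (hx : x ∈ Ω) : G (F x) = x := h.invOn.1 hx

theorem injOn (h : IsDiffeo Ω Ω' F G) : InjOn F Ω := h.invOn.1.injOn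

theorem image_eq (h : IsDiffeo Ω Ω' F G) : F '' Ω = Ω' :=
  h.mapsTo.image_subset.antisymm fun y hy => ⟨G y, h.mapsTo_inv hy, h.invOn.2 hy⟩

theorem fderiv_comp_fderiv (h : IsDiffeo Ω Ω' F G) (hΩ : IsOpen Ω) (hΩ' : IsOpen Ω') {x : E3}
    (hx : x ∈ Ω) : (fderiv ℝ G (F x)).comp (fderiv ℝ F x) = ContinuousLinearMap.id ℝ E3 := by
  have h1 := (h.regular_inv.differentiableAt hΩ' (h.mapsTo hx)).hasFDerivAt.comp x
    (h.regular.differentiableAt hΩ hx).hasFDerivAt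
  have h2 : G ∘ F =ᶠ[𝓝 x] id := by
    filter_upwards [hΩ.mem_nhds hx] with z hz using h.left_inv hz
  exact (h1.congr_of_eventuallyEq h2.symm).unique (hasFDerivAt_id x)

end IsDiffeo

/-! ### The Jacobian matrix -/

theorem jac_apply {F : E3 → E3} {x : E3} (hF : DifferentiableAt ℝ F x) (i j : Fin 3) :
    jac F x i j = fderiv ℝ F x (EuclideanSpace.single j 1) i := by
  have h : HasFDerivAt (fun y => F y i)
      ((EuclideanSpace.proj (𝕜 := ℝ) i).comp (fderiv ℝ F x)) x :=
    (EuclideanSpace.proj (𝕜 := ℝ) i).hasFDerivAt.comp x hF.hasFDerivAt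
  rw [jac, Matrix.of_apply, pderiv, h.fderiv]
  rfl

theorem jac_eq_toMatrix {F : E3 → E3} {x : E3} (hF : DifferentiableAt ℝ F x) :
    jac F x = LinearMap.toMatrix (EuclideanSpace.basisFun (Fin 3) ℝ).toBasis
      (EuclideanSpace.basisFun (Fin 3) ℝ).toBasis (fderiv ℝ F x : E3 →ₗ[ℝ] E3) := by
  ext i j
  rw [jac_apply hF, LinearMap.toMatrix_apply]
  simp

theorem det_jac {F : E3 → E3} {x : E3} (hF : DifferentiableAt ℝ F x) :
    (jac F x).det = (fderiv ℝ F x).det := by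
  rw [jac_eq_toMatrix hF, LinearMap.det_toMatrix]

theorem abs_jac_le {F : E3 → E3} {x : E3} (hF : DifferentiableAt ℝ F x) (i j : Fin 3) :
    |jac F x i j| ≤ ‖fderiv ℝ F x‖ := by
  rw [jac_apply hF, ← Real.norm_eq_abs]
  refine (PiLp.norm_apply_le _ i).trans ?_
  simpa using (fderiv ℝ F x).le_opNorm (EuclideanSpace.single j 1)

theorem abs_det_le {A : Matrix (Fin 3) (Fin 3) ℝ} {c : ℝ} (h : ∀ i j, |A i j| ≤ c) :
    |A.det| ≤ 6 * c ^ 3 := by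
  have hc : 0 ≤ c := (abs_nonneg _).trans (h 0 0)
  have key : ∀ i j k l m n, |A i j * A k l * A m n| ≤ c ^ 3 := fun i j k l m n => by
    rw [abs_mul, abs_mul, pow_succ, pow_two]
    gcongr <;> apply h
  rw [Matrix.det_fin_three]
  have h1 := abs_le.1 (key 0 0 1 1 2 2)
  have h2 := abs_le.1 (key 0 0 1 2 2 1)
  have h3 := abs_le.1 (key 0 1 1 0 2 2)
  have h4 := abs_le.1 (key 0 1 1 2 2 0)
  have h5 := abs_le.1 (key 0 2 1 0 2 1)
  have h6 := abs_le.1 (key 0 2 1 1 2 0)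
  rw [abs_le]
  constructor <;> linarith [h1.1, h1.2, h2.1, h2.2, h3.1, h3.2, h4.1, h4.2, h5.1, h5.2,
    h6.1, h6.2]

theorem continuousOn_jac {Ω : Set E3} (hΩ : IsOpen Ω) {F : E3 → E3}
    (hF : IsC1UpToBoundary Ω F) : ContinuousOn (jac F) Ω := by
  refine continuousOn_pi.2 fun i => continuousOn_pi.2 fun j => ?_
  refine ContinuousOn.congr ?_ fun x hx => jac_apply (hF.differentiableAt hΩ hx) i j
  have h1 := (hF.continuousOn_fderiv hΩ).clm_apply
    (continuousOn_const (c := (EuclideanSpace.single j 1 : E3)))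
  exact (EuclideanSpace.proj (𝕜 := ℝ) i).continuous.comp_continuousOn h1

namespace IsDiffeo

variable {Ω Ω' : Set E3} {F G : E3 → E3}

theorem jac_mul_jac (h : IsDiffeo Ω Ω' F G) (hΩ : IsOpen Ω) (hΩ' : IsOpen Ω') {x : E3}
    (hx : x ∈ Ω) : jac G (F x) * jac F x = 1 := by
  rw [jac_eq_toMatrix (h.regular_inv.differentiableAt hΩ' (h.mapsTo hx)),
    jac_eq_toMatrix (h.regular.differentiableAt hΩ hx), ← LinearMap.toMatrix_comp,
    ← ContinuousLinearMap.toLinearMap_comp, h.fderiv_comp_fderiv hΩ hΩ' hx]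
  exact LinearMap.toMatrix_id _

theorem det_mul_det (h : IsDiffeo Ω Ω' F G) (hΩ : IsOpen Ω) (hΩ' : IsOpen Ω') {x : E3}
    (hx : x ∈ Ω) : (jac G (F x)).det * (jac F x).det = 1 := by
  rw [← Matrix.det_mul, h.jac_mul_jac hΩ hΩ' hx, Matrix.det_one]

theorem det_ne_zero (h : IsDiffeo Ω Ω' F G) (hΩ : IsOpen Ω) (hΩ' : IsOpen Ω') {x : E3}
    (hx : x ∈ Ω) : (jac F x).det ≠ 0 :=
  right_ne_zero_of_mul_eq_one (h.det_mul_det hΩ hΩ' hx)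

/-- The Jacobian determinant has constant sign on a preconnected set. -/
theorem exists_sign (h : IsDiffeo Ω Ω' F G) (hΩ : IsOpen Ω) (hΩ' : IsOpen Ω')
    (hc : IsPreconnected Ω') :
    ∃ σ : ℝ, σ ≠ 0 ∧ ∀ x ∈ Ω, |(jac F x).det| = σ * (jac F x).det := by
  have hpre : IsPreconnected Ω := by
    rw [← h.symm.image_eq]
    exact hc.image _ h.regular_inv.1.continuousOn
  have hcont : ContinuousOn (fun x => (jac F x).det) Ω :=
    continuous_id.matrix_det.comp_continuousOn (continuousOn_jac hΩ h.regular)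
  -- The determinant and its absolute value have equal squares and do not vanish, so by
  -- connectedness they agree everywhere or are opposite everywhere.
  rcases hpre.eq_or_eq_neg_of_sq_eq hcont.abs hcont
    (fun x _ => by simp) (fun hx => h.det_ne_zero hΩ hΩ' hx) with h1 | h1
  · exact ⟨1, one_ne_zero, fun x hx => by simpa using h1 hx⟩
  · exact ⟨-1, by norm_num, fun x hx => by simpa using h1 hx⟩

/-- The distance of `F x` to the unit sphere is controlled by the distance of `x` to `∂Ω`. -/
theorem one_sub_norm_le (h : IsDiffeo Ω (ball (0 : E3) 1) F G) (hΩ : IsOpen Ω)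
    (hb : Bornology.IsBounded Ω) {M : ℝ} (hM0 : 0 < M) (hM : ∀ x ∈ Ω, ‖fderiv ℝ F x‖ ≤ M) {x : E3}
    (hx : x ∈ Ω) : 1 - ‖F x‖ ≤ M * infDist x (frontier Ω) := by
  have hne : Ω ≠ univ := fun hu => NormedSpace.unbounded_univ ℝ E3 (hu ▸ hb)
  have hfr : (frontier Ω).Nonempty := nonempty_frontier_iff.2 ⟨⟨x, hx⟩, hne⟩
  have hcne : Ωᶜ.Nonempty := nonempty_compl.2 hne
  obtain ⟨y, hy, hyd⟩ := hΩ.isClosed_compl.exists_infDist_eq_dist hcne x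
  set d := infDist x Ωᶜ with hd
  have hd0 : 0 < d := by
    rw [hyd, dist_pos]
    rintro rfl
    exact hy hx
  -- `Ω` need not be convex, so the mean value inequality is used only on the ball around `x` that
  -- reaches a nearest point `y` of the complement.
  have hsub : ball x d ⊆ Ω := fun z hz => by
    by_contra hn
    have := infDist_le_dist_of_mem (x := x) (mem_compl hn)
    rw [mem_ball, dist_comm] at hz
    linarith
  have hle : d ≤ infDist x (frontier Ω) := by
    refine infDist_le_infDist_of_subset ?_ hfr
    rw [hΩ.frontier_eq]
    exact fun z hz => hz.2
  have hycl : y ∈ closure (ball x d) := by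
    rw [closure_ball x hd0.ne', mem_closedBall, dist_comm, hyd]
  obtain ⟨F₀, hF₀, he⟩ := h.regular.2.1
  have : (𝓝[ball x d] y).NeBot := mem_closure_iff_nhdsWithin_neBot.1 hycl
  have hlim : Tendsto F (𝓝[ball x d] y) (𝓝 (F₀ y)) := by
    have h1 : Tendsto F₀ (𝓝[ball x d] y) (𝓝 (F₀ y)) :=
      (hF₀ y (closure_mono hsub hycl)).mono (hsub.trans subset_closure)
    refine h1.congr' ?_
    filter_upwards [self_mem_nhdsWithin] with z hz using (he (hsub hz)).symm
  -- The extension sends `y` outside the open ball: otherwise continuity of `G` at `F₀ y` would give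
  -- `y = G (F₀ y) ∈ Ω`.
  have hF₀y : 1 ≤ ‖F₀ y‖ := by
    by_contra hlt
    have hmem : F₀ y ∈ ball (0 : E3) 1 := by simpa using hlt
    have hG := (h.regular_inv.differentiableAt isOpen_ball hmem).continuousAt.tendsto.comp hlim
    have h1 : Tendsto (G ∘ F) (𝓝[ball x d] y) (𝓝 y) := by
      refine (tendsto_id.mono_left nhdsWithin_le_nhds).congr' ?_
      filter_upwards [self_mem_nhdsWithin] with z hz using (h.left_inv (hsub hz)).symm
    have h2 := tendsto_nhds_unique hG h1
    exact hy (h2 ▸ h.mapsTo_inv hmem)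
  have hbound : ‖F₀ y‖ ≤ ‖F x‖ + M * d := by
    refine le_of_tendsto hlim.norm ?_
    filter_upwards [self_mem_nhdsWithin] with z hz
    have h1 := (convex_ball x d).norm_image_sub_le_of_norm_fderiv_le (𝕜 := ℝ)
      (fun w hw => h.regular.differentiableAt hΩ (hsub hw)) (fun w hw => hM w (hsub hw))
      (mem_ball_self hd0) hz
    have h2 : ‖F z‖ ≤ ‖F x‖ + ‖F z - F x‖ := norm_le_norm_add_norm_sub' _ _
    have h3 : ‖z - x‖ ≤ d := (mem_ball_iff_norm.1 hz).le
    nlinarith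
  have := mul_le_mul_of_nonneg_left hle hM0.le
  linarith

end IsDiffeo

/-! ### Real matrices acting on `𝕜`-valued fields -/

section Action

variable {𝕜 : Type*} [RCLike 𝕜]

theorem actOn_apply (A : Matrix (Fin 3) (Fin 3) ℝ) (v : V3 𝕜) (i : Fin 3) :
    actOn A v i = ∑ j, (A i j : 𝕜) * v j := by
  simp [actOn, Matrix.mulVec, dotProduct]

theorem actOn_add (A : Matrix (Fin 3) (Fin 3) ℝ) (u v : V3 𝕜) :
    actOn A (u + v) = actOn A u + actOn A v := by
  ext i
  simp [actOn_apply, mul_add, Finset.sum_add_distrib]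

theorem actOn_smul (A : Matrix (Fin 3) (Fin 3) ℝ) (c : 𝕜) (v : V3 𝕜) :
    actOn A (c • v) = c • actOn A v := by
  ext i
  simp [actOn_apply, Finset.mul_sum, mul_left_comm]

theorem actOn_mul (A B : Matrix (Fin 3) (Fin 3) ℝ) (v : V3 𝕜) :
    actOn (A * B) v = actOn A (actOn B v) := by
  have h : (A * B).map (fun a => (a : 𝕜)) = A.map (fun a => (a : 𝕜)) * B.map fun a => (a : 𝕜) :=
    Matrix.map_mul (f := algebraMap ℝ 𝕜)
  simp [actOn, h]

theorem actOn_one (v : V3 𝕜) : actOn 1 v = v := by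
  ext i
  fin_cases i <;> simp [actOn_apply, Fin.sum_univ_three]

theorem norm_actOn_le {A : Matrix (Fin 3) (Fin 3) ℝ} {c : ℝ} (hA : ∀ i j, |A i j| ≤ c)
    (v : V3 𝕜) : ‖actOn A v‖ ≤ 9 * c * ‖v‖ := by
  have := EuclideanSpace.norm_le_of_forall_le (v := actOn A v) (c := 3 * c * ‖v‖) fun i => by
    rw [actOn_apply]
    exact norm_pair_le (hA i) v
  linarith

theorem pair_actOn (p : Fin 3 → ℝ) (A : Matrix (Fin 3) (Fin 3) ℝ) (v : V3 𝕜) :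
    pair p (actOn A v) = pair (A.transpose.mulVec p) v := by
  simp only [pair, actOn_apply, Matrix.mulVec, dotProduct, Fin.sum_univ_three,
    Matrix.transpose_apply]
  push_cast
  ring

theorem stronglyMeasurable_of_apply {X : Type*} [MeasurableSpace X] {f : X → V3 𝕜}
    (h : ∀ i, StronglyMeasurable fun x => f x i) : StronglyMeasurable f := by
  have : f = fun x => ∑ i, f x i • EuclideanSpace.single i (1 : 𝕜) := by
    ext x j
    simp [Pi.single_apply]
  rw [this]
  exact Finset.stronglyMeasurable_fun_sum _ fun i _ => (h i).smul_const _

theorem StronglyMeasurable.actOn {X : Type*} [MeasurableSpace X]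
    {A : X → Matrix (Fin 3) (Fin 3) ℝ} {v : X → V3 𝕜} (hA : ∀ i j, Measurable fun x => A x i j)
    (hv : StronglyMeasurable v) : StronglyMeasurable fun x => actOn (A x) (v x) := by
  refine stronglyMeasurable_of_apply fun i => ?_
  simp only [actOn_apply]
  refine Finset.stronglyMeasurable_fun_sum _ fun j _ => ?_
  exact (RCLike.continuous_ofReal.comp_stronglyMeasurable (hA i j).stronglyMeasurable).mul
    ((EuclideanSpace.proj (𝕜 := 𝕜) j).continuous.comp_stronglyMeasurable hv)

end Action

/-- Pairing with any `r` gives the determinant of the vectors `Aᵀr, Aᵀp, Aᵀq`, which is `det A`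
times that of `r, p, q`. It governs how a curl transforms under pullback. -/
theorem mulVec_cross_transpose (A : Matrix (Fin 3) (Fin 3) ℝ) (p q : Fin 3 → ℝ) :
    A.mulVec (crossProduct (A.transpose.mulVec p) (A.transpose.mulVec q))
      = A.det • crossProduct p q := by
  ext i
  simp only [Matrix.det_fin_three, Matrix.mulVec, dotProduct, cross_apply, Fin.sum_univ_three,
    Matrix.transpose_apply, Pi.smul_apply, smul_eq_mul]
  fin_cases i <;> simp <;> ring

/-- The exterior derivative `∑ dφᵢ ∧ dxᵢ` in vector notation: each `φᵢ eᵢ` has the form `a ∇b` with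
`b` a coordinate function. -/
theorem sum_grad_cross_single (φ : Fin 3 → E3 → ℝ) (x : E3) :
    ∑ i, crossProduct (grad (φ i) x) (Pi.single i 1) = testCurl φ x := by
  ext j
  simp only [Fin.sum_univ_three, cross_apply, testCurl, grad]
  fin_cases j <;> simp <;> ring

theorem measurable_jac (F : E3 → E3) (i j : Fin 3) : Measurable fun x => jac F x i j :=
  measurable_fderiv_apply_const ℝ (fun y => F y i) (EuclideanSpace.single j 1)

theorem measurable_det_jac (F : E3 → E3) : Measurable fun x => (jac F x).det := by
  simp only [Matrix.det_fin_three]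
  have := measurable_jac F
  fun_prop

/-- The values of the diffeomorphisms off their domains are arbitrary, so measurability is available
only after cutting off. -/
theorem measurable_indicator_of_continuousOn {U : Set E3} (hU : IsOpen U) {F : E3 → E3}
    (hF : ContinuousOn F U) : Measurable (U.indicator F) := by
  classical
  rw [← piecewise_eq_indicator]
  exact hF.measurable_piecewise continuousOn_const hU.measurableSet

/-! ### Pulling back `C¹` test functions -/

namespace IsDiffeo

variable {Ω Ω' : Set E3} {F G : E3 → E3}

theorem contDiffAt (h : IsDiffeo Ω Ω' F G) (hΩ : IsOpen Ω) {x : E3} (hx : x ∈ Ω) :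
    ContDiffAt ℝ 1 F x :=
  h.regular.1.contDiffAt (hΩ.mem_nhds hx)

/-- The support is contained in the compact set `G '' tsupport φ` inside `Ω`, so extension by zero
creates no singularity at `∂Ω`. The regularity is that of `F`, hence the need for `C¹` test
functions. -/
theorem isC1Test_pullback (h : IsDiffeo Ω Ω' F G) (hΩ : IsOpen Ω) {φ : E3 → ℝ}
    (hφ : IsC1Test Ω' φ) : IsC1Test Ω (Ω.indicator (φ ∘ F)) := by
  set K := G '' tsupport φ
  have hK : IsCompact K := hφ.hasCompactSupport.isCompact.image_of_continuousOn
    (h.regular_inv.1.continuousOn.mono hφ.tsupport_subset)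
  have hKΩ : K ⊆ Ω := by
    rintro _ ⟨y, hy, rfl⟩
    exact h.mapsTo_inv (hφ.tsupport_subset hy)
  have hz : ∀ x ∉ K, Ω.indicator (φ ∘ F) x = 0 := by
    intro x hx
    by_cases hxΩ : x ∈ Ω
    · rw [indicator_of_mem hxΩ]
      exact image_eq_zero_of_notMem_tsupport (f := φ) fun hn => hx ⟨F x, hn, h.left_inv hxΩ⟩
    · exact indicator_of_notMem hxΩ _
  have hsup : tsupport (Ω.indicator (φ ∘ F)) ⊆ K :=
    closure_minimal (fun x hx => not_not.1 fun hn => hx (hz x hn)) hK.isClosed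
  refine ⟨contDiff_iff_contDiffAt.2 fun x => ?_, hK.of_isClosed_subset (isClosed_tsupport _) hsup,
    hsup.trans hKΩ⟩
  by_cases hx : x ∈ Ω
  · refine (hφ.contDiff.contDiffAt.comp x (h.contDiffAt hΩ hx)).congr_of_eventuallyEq ?_
    filter_upwards [hΩ.mem_nhds hx] with z hz using indicator_of_mem hz _
  · refine (contDiffAt_const (c := (0 : ℝ))).congr_of_eventuallyEq ?_
    filter_upwards [hK.isClosed.isOpen_compl.mem_nhds fun hn => hx (hKΩ hn)] with z hzK
      using hz z hzK

theorem grad_comp (h : IsDiffeo Ω Ω' F G) (hΩ : IsOpen Ω) {φ : E3 → ℝ} {x : E3} (hx : x ∈ Ω)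
    (hφ : DifferentiableAt ℝ φ (F x)) :
    grad (Ω.indicator (φ ∘ F)) x = (jac F x).transpose.mulVec (grad φ (F x)) := by
  have hF := h.regular.differentiableAt hΩ hx
  have h1 : Ω.indicator (φ ∘ F) =ᶠ[𝓝 x] φ ∘ F := by
    filter_upwards [hΩ.mem_nhds hx] with z hz using indicator_of_mem hz _
  ext j
  rw [grad, pderiv, h1.fderiv_eq, fderiv_comp x hφ hF, ContinuousLinearMap.comp_apply,
    fderiv_apply_eq_sum]
  simp only [Matrix.mulVec, dotProduct, Matrix.transpose_apply, jac_apply hF, grad]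

end IsDiffeo

theorem grad_coord_eq (G : E3 → E3) (y : E3) (i : Fin 3) :
    grad (fun z => G z i) y = (jac G y).transpose.mulVec (Pi.single i 1) := by
  ext j
  simp [grad, jac]

/-- A `C¹` function on the ball can be replaced by a `C¹` test function without changing its
gradient on the support of a given test function. -/
theorem IsC1Test.exists_grad_eq {a g : E3 → ℝ} (ha : IsC1Test (ball (0 : E3) 1) a)
    (hg : ContDiffOn ℝ 1 g (ball (0 : E3) 1)) :
    ∃ b, IsC1Test (ball (0 : E3) 1) b ∧ ∀ y ∈ tsupport a, grad b y = grad g y := by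
  obtain ⟨r, hr1, hr⟩ := exists_lt_subset_ball (isClosed_tsupport a) ha.tsupport_subset
  -- `r` has no known sign (the support may be empty), so it is replaced by `max r 0`.
  obtain ⟨r₁, hr₁, hr₁1⟩ := exists_between (max_lt hr1 one_pos)
  obtain ⟨r₂, hr₂, hr₂1⟩ := exists_between hr₁1
  have hr₁0 : 0 < r₁ := (le_max_right _ _).trans_lt hr₁
  let χ : ContDiffBump (0 : E3) := ⟨r₁, r₂, hr₁0, hr₂⟩
  have hχ : tsupport χ ⊆ ball 0 1 := by
    rw [χ.tsupport_eq]
    exact closedBall_subset_ball hr₂1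
  have hsup : tsupport (fun y => χ y * g y) ⊆ tsupport χ := tsupport_mul_subset_left
  refine ⟨fun y => χ y * g y, ⟨contDiff_iff_contDiffAt.2 fun y => ?_, χ.hasCompactSupport.mul_right,
    hsup.trans hχ⟩, fun y hy => ?_⟩
  · by_cases hy : y ∈ ball (0 : E3) 1
    · exact χ.contDiff.contDiffAt.mul (hg.contDiffAt (isOpen_ball.mem_nhds hy))
    · refine (contDiffAt_const (c := (0 : ℝ))).congr_of_eventuallyEq ?_
      have : y ∉ tsupport (fun y => χ y * g y) := fun hn => hy (hχ (hsup hn))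
      exact notMem_tsupport_iff_eventuallyEq.1 this
  · have h1 : (fun y => χ y * g y) =ᶠ[𝓝 y] g := by
      have hy1 : y ∈ ball (0 : E3) r₁ :=
        ball_subset_ball ((le_max_left _ _).trans hr₁.le) (hr hy)
      filter_upwards [isOpen_ball.mem_nhds hy1] with z hz
      rw [χ.one_of_mem_closedBall (ball_subset_closedBall hz), one_mul]
    ext j
    rw [grad, grad, pderiv, pderiv, h1.fderiv_eq]

/-! ### Change of variables -/

namespace IsDiffeo

variable {Ω Ω' : Set E3} {F G : E3 → E3}

theorem hasFDerivWithinAt (h : IsDiffeo Ω Ω' F G) (hΩ : IsOpen Ω) :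
    ∀ x ∈ Ω, HasFDerivWithinAt F (fderiv ℝ F x) Ω x := fun _ hx =>
  (h.regular.differentiableAt hΩ hx).hasFDerivAt.hasFDerivWithinAt

theorem setLIntegral_eq (h : IsDiffeo Ω Ω' F G) (hΩ : IsOpen Ω) (g : E3 → ℝ≥0∞) :
    ∫⁻ y in Ω', g y = ∫⁻ x in Ω, ENNReal.ofReal |(jac F x).det| * g (F x) := by
  rw [← h.image_eq, lintegral_image_eq_lintegral_abs_det_fderiv_mul volume hΩ.measurableSet
    (h.hasFDerivWithinAt hΩ) h.injOn]
  refine setLIntegral_congr_fun hΩ.measurableSet fun x hx => ?_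
  rw [det_jac (h.regular.differentiableAt hΩ hx)]

theorem setIntegral_eq {E : Type*} [NormedAddCommGroup E] [NormedSpace ℝ E]
    (h : IsDiffeo Ω Ω' F G) (hΩ : IsOpen Ω) (g : E3 → E) :
    ∫ y in Ω', g y = ∫ x in Ω, |(jac F x).det| • g (F x) := by
  rw [← h.image_eq, integral_image_eq_integral_abs_det_fderiv_smul volume hΩ.measurableSet
    (h.hasFDerivWithinAt hΩ) h.injOn]
  refine setIntegral_congr_fun hΩ.measurableSet fun x hx => ?_
  simp only [det_jac (h.regular.differentiableAt hΩ hx)]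

/-- The exceptional set in `Ω` is the image under the differentiable map `G` of a null set, hence
null. -/
theorem ae_comp (h : IsDiffeo Ω Ω' F G) (hΩ : IsOpen Ω) (hΩ' : IsOpen Ω') {P : E3 → Prop}
    (hP : ∀ᵐ y ∂volume.restrict Ω', P y) : ∀ᵐ x ∂volume.restrict Ω, P (F x) := by
  rw [ae_restrict_iff' hΩ'.measurableSet] at hP
  rw [ae_restrict_iff' hΩ.measurableSet]
  have h1 : volume (Ω' ∩ {y | ¬ (y ∈ Ω' → P y)}) = 0 := measure_mono_null inter_subset_right hP
  have h2 := addHaar_image_eq_zero_of_differentiableOn_of_addHaar_eq_zero volume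
    ((h.regular_inv.1.differentiableOn one_ne_zero).mono inter_subset_left) h1
  refine measure_mono_null (fun x hx => ?_) h2
  simp only [mem_compl_iff, mem_ofPred_eq, Classical.not_imp] at hx
  exact ⟨F x, ⟨h.mapsTo hx.1, fun hn => hx.2 (hn (h.mapsTo hx.1))⟩, h.left_inv hx.1⟩

end IsDiffeo

/-! ### The transported field -/

section Transported

variable {𝕜 : Type*} [RCLike 𝕜] {Ω : Set E3} {F G : E3 → E3} {f : E3 → V3 𝕜}

theorem transported_add (f g : E3 → V3 𝕜) (y : E3) :
    transported F G (f + g) y = transported F G f y + transported F G g y := by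
  simp [transported, actOn_add]

theorem transported_smul (c : 𝕜) (f : E3 → V3 𝕜) (y : E3) :
    transported F G (c • f) y = c • transported F G f y := by
  simp only [transported, Pi.smul_apply, actOn_smul]
  rw [smul_comm]

/-- The transported field, extended by zero outside the unit ball. -/
noncomputable def transportedExt (F G : E3 → E3) (f : E3 → V3 𝕜) : E3 → V3 𝕜 :=
  (ball (0 : E3) 1).indicator (transported F G f)

theorem transportedExt_of_notMem {z : E3} (hz : z ∉ ball (0 : E3) 1) :
    transportedExt F G f z = 0 :=
  indicator_of_notMem hz _

namespace IsDiffeo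

theorem transported_apply (h : IsDiffeo Ω (ball (0 : E3) 1) F G) {x : E3} (hx : x ∈ Ω) :
    transported F G f (F x) = (jac F x).det⁻¹ • actOn (jac F x) (f x) := by
  rw [transported, h.left_inv hx]

theorem transportedExt_apply (h : IsDiffeo Ω (ball (0 : E3) 1) F G) {x : E3} (hx : x ∈ Ω) :
    transportedExt F G f (F x) = (jac F x).det⁻¹ • actOn (jac F x) (f x) := by
  rw [transportedExt, indicator_of_mem (h.mapsTo hx), h.transported_apply hx]

theorem stronglyMeasurable_transportedExt (h : IsDiffeo Ω (ball (0 : E3) 1) F G)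
    (hf : StronglyMeasurable f) : StronglyMeasurable (transportedExt F G f) := by
  set G' := (ball (0 : E3) 1).indicator G with hG'
  have hGm : Measurable G' :=
    measurable_indicator_of_continuousOn isOpen_ball h.regular_inv.1.continuousOn
  have h1 : transportedExt F G f = (ball (0 : E3) 1).indicator (transported F G' f) := by
    refine indicator_congr fun y hy => ?_
    rw [transported, transported, hG', indicator_of_mem hy]
  rw [h1]
  refine StronglyMeasurable.indicator ?_ measurableSet_ball
  refine StronglyMeasurable.smul (f := fun y => (jac F (G' y)).det⁻¹)
    ((measurable_det_jac F).comp hGm).inv.stronglyMeasurable ?_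
  exact StronglyMeasurable.actOn (A := fun y => jac F (G' y))
    (fun i j => (measurable_jac F i j).comp hGm) (hf.comp_measurable hGm)

/-- Common bounds for the derivatives and Jacobian determinants of a diffeomorphism. -/
theorem exists_bounds (h : IsDiffeo Ω (ball (0 : E3) 1) F G) (hΩ : IsOpen Ω) :
    ∃ M : ℝ, 0 < M ∧ (∀ x ∈ Ω, ‖fderiv ℝ F x‖ ≤ M) ∧ (∀ x ∈ Ω, ∀ i j, |jac F x i j| ≤ M) ∧
      (∀ x ∈ Ω, |(jac F x).det| ≤ M) ∧ (∀ x ∈ Ω, |(jac F x).det⁻¹| ≤ M) := by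
  have hb : Bornology.IsBounded Ω := by
    rw [← h.symm.image_eq]
    exact h.regular_inv.isBounded_image isBounded_ball
  obtain ⟨M₁, hM₁, hF⟩ := h.regular.exists_norm_fderiv_le hb
  obtain ⟨M₂, hM₂, hG⟩ := h.regular_inv.exists_norm_fderiv_le isBounded_ball
  have hFj : ∀ x ∈ Ω, ∀ i j, |jac F x i j| ≤ M₁ := fun x hx i j =>
    (abs_jac_le (h.regular.differentiableAt hΩ hx) i j).trans (hF x hx)
  have hGj : ∀ x ∈ Ω, ∀ i j, |jac G (F x) i j| ≤ M₂ := fun x hx i j =>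
    (abs_jac_le (h.regular_inv.differentiableAt isOpen_ball (h.mapsTo hx)) i j).trans
      (hG _ (h.mapsTo hx))
  have h1 : 0 < 6 * M₁ ^ 3 := by positivity
  have h2 : 0 < 6 * M₂ ^ 3 := by positivity
  refine ⟨M₁ + 6 * M₁ ^ 3 + 6 * M₂ ^ 3, by positivity, fun x hx => ?_, fun x hx i j => ?_,
    fun x hx => ?_, fun x hx => ?_⟩
  · linarith [hF x hx]
  · linarith [hFj x hx i j]
  · linarith [abs_det_le (hFj x hx)]
  -- The reciprocal of the determinant is the determinant of `∇G` at `F x`, so the entrywise bound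
  -- for `∇G` controls it.
  · rw [← eq_inv_of_mul_eq_one_left (h.det_mul_det hΩ isOpen_ball hx)]
    linarith [abs_det_le (hGj x hx)]

/-- The weight is arbitrary so that one constant serves both the plain `L²` bound and the weight `(1
- |y|)^α`. -/
theorem exists_lintegral_transportedExt_le (h : IsDiffeo Ω (ball (0 : E3) 1) F G)
    (hΩ : IsOpen Ω) :
    ∃ C : ℝ, 0 < C ∧ ∀ (f : E3 → V3 𝕜) (w : E3 → ℝ≥0∞),
      ∫⁻ y in ball (0 : E3) 1, w y * ‖transportedExt F G f y‖ₑ ^ 2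
        ≤ ENNReal.ofReal C * ∫⁻ x in Ω, w (F x) * ‖f x‖ₑ ^ 2 := by
  obtain ⟨M, hM, -, hj, hd, hdi⟩ := h.exists_bounds hΩ
  refine ⟨M * (9 * M ^ 2) ^ 2, by positivity, fun f w => ?_⟩
  rw [h.setLIntegral_eq hΩ, ← lintegral_const_mul' _ _ ENNReal.ofReal_ne_top]
  refine setLIntegral_mono' hΩ.measurableSet fun x hx => ?_
  have h1 : ‖transportedExt F G f (F x)‖ₑ ≤ ENNReal.ofReal (9 * M ^ 2) * ‖f x‖ₑ := by
    rw [← ofReal_norm, ← ofReal_norm, ← ENNReal.ofReal_mul (by positivity),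
      h.transportedExt_apply hx, norm_smul]
    refine ENNReal.ofReal_le_ofReal ?_
    have := mul_le_mul (hdi x hx) (norm_actOn_le (hj x hx) (f x)) (norm_nonneg _) hM.le
    rw [Real.norm_eq_abs]
    linarith
  calc ENNReal.ofReal |(jac F x).det| * (w (F x) * ‖transportedExt F G f (F x)‖ₑ ^ 2)
      ≤ ENNReal.ofReal M * (w (F x) * (ENNReal.ofReal (9 * M ^ 2) * ‖f x‖ₑ) ^ 2) := by
        gcongr
        exact hd x hx
    _ = _ := by
        rw [ENNReal.ofReal_mul hM.le, ENNReal.ofReal_pow (by positivity : 0 ≤ 9 * M ^ 2)]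
        ring

theorem memLp_transportedExt (h : IsDiffeo Ω (ball (0 : E3) 1) F G) (hΩ : IsOpen Ω)
    (hf : StronglyMeasurable f) (hL : MemLp f 2 (volume.restrict Ω)) :
    MemLp (transportedExt F G f) 2 volume := by
  refine ⟨(h.stronglyMeasurable_transportedExt hf).aestronglyMeasurable, ?_⟩
  obtain ⟨C, -, hC⟩ := h.exists_lintegral_transportedExt_le (𝕜 := 𝕜) hΩ
  have h1 := hC f 1
  have h2 : ∫⁻ x in Ω, ‖f x‖ₑ ^ 2 < ⊤ := by
    simpa using lintegral_rpow_enorm_lt_top_of_eLpNorm_lt_top (by norm_num) (by norm_num) hL.2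
  rw [eLpNorm_lt_top_iff_lintegral_rpow_enorm_lt_top (by norm_num) (by norm_num)]
  simp only [ENNReal.toReal_ofNat, ENNReal.rpow_two]
  simp only [Pi.one_apply, one_mul] at h1
  rw [setLIntegral_eq_of_support_subset] at h1
  · exact h1.trans_lt (ENNReal.mul_lt_top ENNReal.ofReal_lt_top h2)
  · intro y hy
    by_contra hn
    exact hy (by simp [transportedExt_of_notMem hn])

/-- The Piola property: `∇F` is moved onto the test gradient, giving `∇(φ ∘ F)`, while `1/det ∇F`
cancels the Jacobian of the change of variables up to its constant sign. -/
theorem isWeakDiv_transportedExt (h : IsDiffeo Ω (ball (0 : E3) 1) F G) (hΩ : IsOpen Ω)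
    (hf : IntegrableOn f Ω) (hdiv : IsWeakDiv Ω f (fun _ => (0 : 𝕜))) :
    IsWeakDiv (ball (0 : E3) 1) (transportedExt F G f) (fun _ => (0 : 𝕜)) := by
  intro φ hφ
  obtain ⟨σ, -, hσ⟩ := h.exists_sign hΩ isOpen_ball (convex_ball _ _).isPreconnected
  have h1 := integral_pair_grad_eq_zero hΩ hf hdiv (h.isC1Test_pullback hΩ hφ.isC1Test)
  have h2 : ∫ y in ball (0 : E3) 1, pair (grad φ y) (transportedExt F G f y)
      = σ • ∫ x in Ω, pair (grad (Ω.indicator (φ ∘ F)) x) (f x) := by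
    rw [h.setIntegral_eq hΩ, ← integral_smul]
    refine setIntegral_congr_fun hΩ.measurableSet fun x hx => ?_
    have hd := h.det_ne_zero hΩ isOpen_ball hx
    rw [h.transportedExt_apply hx, pair_smul_right, pair_actOn,
      h.grad_comp hΩ hx (hφ.differentiableAt _), smul_smul, hσ x hx, mul_assoc,
      mul_inv_cancel₀ hd, mul_one]
  rw [h1, smul_zero] at h2
  simp only [mul_zero, integral_zero, zero_eq_neg]
  exact h2

end IsDiffeo

end Transported

/-! ### The potential on `Ω` -/

section Potential

variable {𝕜 : Type*} [RCLike 𝕜] {Ω : Set E3} {F G : E3 → E3} {f : E3 → V3 𝕜}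

theorem radialIntegrand_transportedExt {y : E3} (hy : y ∈ ball (0 : E3) 1) {t : ℝ}
    (ht : t ∈ Icc (0 : ℝ) 1) :
    radialIntegrand (transportedExt F G f) y t = radialIntegrand (transported F G f) y t := by
  have hty : t • y ∈ ball (0 : E3) 1 := by
    rw [mem_ball_zero_iff] at hy ⊢
    rw [norm_smul, Real.norm_of_nonneg ht.1]
    exact (mul_le_of_le_one_left (norm_nonneg _) ht.2).trans_lt hy
  rw [radialIntegrand, radialIntegrand, transportedExt, indicator_of_mem hty]

theorem radialPotential_transportedExt {y : E3} (hy : y ∈ ball (0 : E3) 1) :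
    radialPotential (transportedExt F G f) y = radialPotential (transported F G f) y := by
  rw [radialPotential, radialPotential]
  congr 1
  refine intervalIntegral.integral_congr fun t ht => ?_
  rw [uIcc_of_le zero_le_one] at ht
  exact radialIntegrand_transportedExt hy ht

/-- The potential `∇F(x)ᵀ F'(F(x))` of the field `f`. -/
noncomputable def transportedPotential (F G : E3 → E3) (f : E3 → V3 𝕜) (x : E3) : V3 𝕜 :=
  actOn (jac F x).transpose (radialPotential (transported F G f) (F x))

namespace IsDiffeo

theorem transportedPotential_apply (h : IsDiffeo Ω (ball (0 : E3) 1) F G) {x : E3}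
    (hx : x ∈ Ω) :
    transportedPotential F G f x
      = actOn (jac F x).transpose (radialPotential (transportedExt F G f) (F x)) := by
  rw [transportedPotential, radialPotential_transportedExt (h.mapsTo hx)]

theorem aestronglyMeasurable_transportedPotential (h : IsDiffeo Ω (ball (0 : E3) 1) F G)
    (hΩ : IsOpen Ω) (hf : StronglyMeasurable f) :
    AEStronglyMeasurable (transportedPotential F G f) (volume.restrict Ω) := by
  have hFm : Measurable (Ω.indicator F) :=
    measurable_indicator_of_continuousOn hΩ h.regular.1.continuousOn
  have h1 := (stronglyMeasurable_radialPotential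
    (h.stronglyMeasurable_transportedExt hf)).comp_measurable hFm
  refine ⟨_, StronglyMeasurable.actOn (A := fun x => (jac F x).transpose)
    (fun i j => measurable_jac F j i) h1, ?_⟩
  filter_upwards [ae_restrict_mem hΩ.measurableSet] with x hx
  rw [h.transportedPotential_apply hx, Function.comp_apply, indicator_of_mem hx]

/-- The weighted estimate for the potential. -/
theorem exists_lintegral_transportedPotential_le (h : IsDiffeo Ω (ball (0 : E3) 1) F G)
    (hΩ : IsOpen Ω) {α : ℝ} (hα₀ : 0 ≤ α) (hα₂ : α < 2) :
    ∃ C : ℝ, 0 < C ∧ ∀ f : E3 → V3 𝕜, StronglyMeasurable f →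
      ∫⁻ x in Ω, ‖transportedPotential F G f x‖ₑ ^ 2 ≤ ENNReal.ofReal C *
        ∫⁻ x in Ω, ENNReal.ofReal (infDist x (frontier Ω) ^ α) * ‖f x‖ₑ ^ 2 := by
  obtain ⟨M, hM, hF, hj, hd, hdi⟩ := h.exists_bounds hΩ
  obtain ⟨C, hC0, hC⟩ := h.exists_lintegral_transportedExt_le (𝕜 := 𝕜) hΩ
  have hb : Bornology.IsBounded Ω := by
    rw [← h.symm.image_eq]
    exact h.regular_inv.isBounded_image isBounded_ball
  set K := ∫⁻ t in Ioo (0 : ℝ) 1, ENNReal.ofReal (betaKernel α t)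
  have hK : K ≠ ⊤ := (lintegral_betaKernel_lt_top hα₂).ne
  set D := ENNReal.ofReal (M * (54 * M) ^ 2) * (K ^ 2 *
    (ENNReal.ofReal C * ENNReal.ofReal (M ^ α)))
  have hD : D ≠ ⊤ := ENNReal.mul_ne_top ENNReal.ofReal_ne_top (ENNReal.mul_ne_top
    (ENNReal.pow_ne_top hK) (ENNReal.mul_ne_top ENNReal.ofReal_ne_top ENNReal.ofReal_ne_top))
  -- Adding `1` only ensures strict positivity.
  refine ⟨D.toReal + 1, by positivity, fun f hf => ?_⟩
  set g := transportedExt F G f with hg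
  have hgm := h.stronglyMeasurable_transportedExt hf
  have hMα : 0 ≤ M ^ α := Real.rpow_nonneg hM.le α
  have h1 : ∫⁻ x in Ω, ‖transportedPotential F G f x‖ₑ ^ 2
      ≤ ENNReal.ofReal (M * (54 * M) ^ 2) *
        ∫⁻ y in ball (0 : E3) 1, radialAvg (fun z => ‖g z‖ₑ) y ^ 2 := by
    rw [h.setLIntegral_eq hΩ, ← lintegral_const_mul' _ _ ENNReal.ofReal_ne_top]
    refine setLIntegral_mono' hΩ.measurableSet fun x hx => ?_
    have h2 : ‖transportedPotential F G f x‖ₑ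
        ≤ ENNReal.ofReal (54 * M) * radialAvg (fun z => ‖g z‖ₑ) (F x) := by
      have h3 : ‖transportedPotential F G f x‖ₑ
          ≤ ENNReal.ofReal (9 * M) * ‖radialPotential g (F x)‖ₑ := by
        rw [← ofReal_norm, ← ofReal_norm, ← ENNReal.ofReal_mul (by positivity),
          h.transportedPotential_apply hx]
        exact ENNReal.ofReal_le_ofReal (norm_actOn_le (fun i j => hj x hx j i) _)
      refine h3.trans ((mul_le_mul_right (enorm_radialPotential_le (h.mapsTo hx)) _).trans_eq ?_)
      rw [← mul_assoc, ← ENNReal.ofReal_ofNat 6, ← ENNReal.ofReal_mul (by positivity)]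
      congr 2
      ring
    -- The lower bound on the Jacobian allows it to be inserted before passing to the ball.
    have h4 : 1 ≤ M * |(jac F x).det| := by
      have h5 : |(jac F x).det⁻¹| * |(jac F x).det| = 1 := by
        rw [← abs_mul, inv_mul_cancel₀ (h.det_ne_zero hΩ isOpen_ball hx), abs_one]
      rw [← h5]
      exact mul_le_mul_of_nonneg_right (hdi x hx) (abs_nonneg _)
    calc ‖transportedPotential F G f x‖ₑ ^ 2
        ≤ 1 * (ENNReal.ofReal (54 * M) * radialAvg (fun z => ‖g z‖ₑ) (F x)) ^ 2 := by
          rw [one_mul]; gcongr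
      _ ≤ ENNReal.ofReal (M * |(jac F x).det|)
          * (ENNReal.ofReal (54 * M) * radialAvg (fun z => ‖g z‖ₑ) (F x)) ^ 2 := by
          gcongr
          rw [← ENNReal.ofReal_one]
          exact ENNReal.ofReal_le_ofReal h4
      _ = _ := by
          rw [ENNReal.ofReal_mul hM.le, ENNReal.ofReal_mul hM.le,
            ENNReal.ofReal_pow (by positivity : 0 ≤ 54 * M)]
          ring
  have h2 := setLIntegral_radialAvg_sq_le hα₀ hgm.enorm
  have h3 := hC f fun z => ENNReal.ofReal ((1 - ‖z‖) ^ α)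
  have h4 : ∫⁻ x in Ω, ENNReal.ofReal ((1 - ‖F x‖) ^ α) * ‖f x‖ₑ ^ 2
      ≤ ENNReal.ofReal (M ^ α) *
        ∫⁻ x in Ω, ENNReal.ofReal (infDist x (frontier Ω) ^ α) * ‖f x‖ₑ ^ 2 := by
    rw [← lintegral_const_mul' _ _ ENNReal.ofReal_ne_top]
    refine setLIntegral_mono' hΩ.measurableSet fun x hx => ?_
    rw [← mul_assoc, ← ENNReal.ofReal_mul hMα, ← Real.mul_rpow hM.le infDist_nonneg]
    have hFx : 0 ≤ 1 - ‖F x‖ := sub_nonneg.2 (mem_ball_zero_iff.1 (h.mapsTo hx)).le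
    have := h.one_sub_norm_le hΩ hb hM hF hx
    gcongr
  calc _ ≤ D * ∫⁻ x in Ω, ENNReal.ofReal (infDist x (frontier Ω) ^ α) * ‖f x‖ₑ ^ 2 := by
        refine h1.trans ?_
        simp only [D, mul_assoc]
        gcongr
        refine h2.trans ?_
        gcongr
        refine h3.trans ?_
        gcongr
    _ ≤ _ := by
        gcongr
        rw [← ENNReal.ofReal_toReal hD]
        exact ENNReal.ofReal_le_ofReal (by rw [ENNReal.ofReal_toReal hD]; linarith)

theorem memLp_transportedPotential (h : IsDiffeo Ω (ball (0 : E3) 1) F G) (hΩ : IsOpen Ω)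
    (hf : StronglyMeasurable f) (hL : MemLp f 2 (volume.restrict Ω)) :
    MemLp (transportedPotential F G f) 2 (volume.restrict Ω) := by
  refine ⟨h.aestronglyMeasurable_transportedPotential hΩ hf, ?_⟩
  obtain ⟨C, -, hC⟩ := h.exists_lintegral_transportedPotential_le (𝕜 := 𝕜) hΩ le_rfl two_pos
  have h1 := hC f hf
  have h2 : ∫⁻ x in Ω, ‖f x‖ₑ ^ 2 < ⊤ := by
    simpa using lintegral_rpow_enorm_lt_top_of_eLpNorm_lt_top (by norm_num) (by norm_num) hL.2
  rw [eLpNorm_lt_top_iff_lintegral_rpow_enorm_lt_top (by norm_num) (by norm_num)]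
  simp only [ENNReal.toReal_ofNat, ENNReal.rpow_two]
  simp only [Real.rpow_zero, ENNReal.ofReal_one, one_mul] at h1
  exact h1.trans_lt (ENNReal.mul_lt_top ENNReal.ofReal_lt_top h2)

/-- The potential has weak curl `f`. -/
theorem isWeakCurl_transportedPotential (h : IsDiffeo Ω (ball (0 : E3) 1) F G) (hΩ : IsOpen Ω)
    (hf : StronglyMeasurable f) (hL : MemLp f 2 (volume.restrict Ω)) (hi : IntegrableOn f Ω)
    (hdiv : IsWeakDiv Ω f (fun _ => (0 : 𝕜))) :
    IsWeakCurl Ω (transportedPotential F G f) f := by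
  intro φ hφ
  set g := transportedExt F G f with hg
  have hgm : StronglyMeasurable g := h.stronglyMeasurable_transportedExt hf
  have hgL : MemLp g 2 volume := h.memLp_transportedExt hΩ hf hL
  have hgi : IntegrableOn g (ball 0 1) := MemLp.integrableOn_ball (hgL.restrict _)
  have hpi : IntegrableOn (radialPotential g) (ball 0 1) :=
    MemLp.integrableOn_ball (memLp_radialPotential hgm hgL)
  obtain ⟨σ, hσ0, hσ⟩ := h.exists_sign hΩ isOpen_ball (convex_ball _ _).isPreconnected
  -- The pulled-back test form is `∑ aᵢ dGᵢ` with `aᵢ = φᵢ ∘ G`. Each coordinate `Gᵢ` is replaced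
  -- below by a `C¹` test function `bᵢ` with the same gradient on the support of `aᵢ`.
  let a : Fin 3 → E3 → ℝ := fun i => (ball (0 : E3) 1).indicator (φ i ∘ G)
  have ha : ∀ i, IsC1Test (ball (0 : E3) 1) (a i) := fun i =>
    h.symm.isC1Test_pullback isOpen_ball (hφ i).isC1Test
  have hGi : ∀ i, ContDiffOn ℝ 1 (fun y => G y i) (ball (0 : E3) 1) := fun i =>
    (EuclideanSpace.proj (𝕜 := ℝ) i).contDiff.comp_contDiffOn h.regular_inv.1
  choose b hb hbG using fun i => (ha i).exists_grad_eq (hGi i)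
  have hsum : ∑ i, ∫ y in ball (0 : E3) 1, pair (a i y • grad (b i) y) (g y)
      = ∑ i, ∫ y in ball (0 : E3) 1,
        pair (crossProduct (grad (a i) y) (grad (b i) y)) (radialPotential g y) :=
    Finset.sum_congr rfl fun i _ => integral_pair_cross_grad_radialPotential hgm hgL
      (fun z hz => transportedExt_of_notMem hz) (h.isWeakDiv_transportedExt hΩ hi hdiv)
      (ha i) (hb i)
  have hint1 : ∀ i, IntegrableOn (fun y => pair (a i y • grad (b i) y) (g y)) (ball 0 1) :=
    fun i => by
      obtain ⟨c, hc⟩ := (ha i).exists_bound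
      obtain ⟨d, hd⟩ := (hb i).exists_bound
      refine Integrable.pair (c := c * d) (fun j => ((ha i).contDiff.continuous.mul
        ((hb i).continuous_pderiv j)).aestronglyMeasurable) (fun y j => ?_) hgi
      rw [Pi.smul_apply, smul_eq_mul, abs_mul]
      exact mul_le_mul (hc y).1 ((hd y).2 j) (abs_nonneg _) ((abs_nonneg _).trans (hc y).1)
  have hint2 : ∀ i, IntegrableOn (fun y => pair (crossProduct (grad (a i) y) (grad (b i) y))
      (radialPotential g y)) (ball 0 1) := fun i => by
    obtain ⟨c, hc⟩ := (ha i).exists_bound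
    obtain ⟨d, hd⟩ := (hb i).exists_bound
    exact Integrable.pair (fun j => (continuous_cross_apply (ha i).continuous_pderiv
        (hb i).continuous_pderiv j).aestronglyMeasurable)
      (fun y j => abs_cross_le (c := max c d)
        (fun k => ((hc y).2 k).trans (le_max_left _ _))
        (fun k => ((hd y).2 k).trans (le_max_right _ _)) j) hpi
  rw [← integral_finsetSum _ fun i _ => hint1 i, ← integral_finsetSum _ fun i _ => hint2 i,
    h.setIntegral_eq hΩ, h.setIntegral_eq hΩ] at hsum
  have hax : ∀ x ∈ Ω, ∀ i, a i (F x) = φ i x := fun x hx i => by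
    simp only [a, indicator_of_mem (h.mapsTo hx), Function.comp_apply, h.left_inv hx]
  have hgrada : ∀ x ∈ Ω, ∀ i, grad (a i) (F x)
      = (jac G (F x)).transpose.mulVec (grad (φ i) x) := fun x hx i => by
    have h1 := h.symm.grad_comp isOpen_ball (h.mapsTo hx)
      (((hφ i).differentiableAt (G (F x))))
    rwa [h.left_inv hx] at h1
  have hgradb : ∀ x, ∀ i, F x ∈ tsupport (a i) → grad (b i) (F x)
      = (jac G (F x)).transpose.mulVec (Pi.single i 1) := fun x i hx => by
    rw [hbG i _ hx, grad_coord_eq]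
  -- Here `∇G` cancels the `∇F` in the Piola transform, and the two determinants leave the sign `σ`.
  have hleft : ∀ x ∈ Ω, |(jac F x).det| • ∑ i, pair (a i (F x) • grad (b i) (F x)) (g (F x))
      = σ • pair (fun i => φ i x) (f x) := fun x hx => by
    have h1 : ∀ i, a i (F x) • grad (b i) (F x)
        = φ i x • (jac G (F x)).transpose.mulVec (Pi.single i 1) := fun i => by
      by_cases hs : F x ∈ tsupport (a i)
      · rw [hax x hx, hgradb x i hs]
      · rw [← hax x hx, image_eq_zero_of_notMem_tsupport hs, zero_smul, zero_smul]
    have h2 : ∀ i, pair (a i (F x) • grad (b i) (F x)) (g (F x))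
        = (jac F x).det⁻¹ • ((φ i x : 𝕜) * f x i) := fun i => by
      rw [h1, pair_smul_left, ← pair_actOn, hg, h.transportedExt_apply hx]
      have h3 : actOn (jac G (F x)) ((jac F x).det⁻¹ • actOn (jac F x) (f x))
          = (jac F x).det⁻¹ • f x := by
        rw [RCLike.real_smul_eq_coe_smul (K := 𝕜), actOn_smul, ← actOn_mul,
          h.jac_mul_jac hΩ isOpen_ball hx, actOn_one, ← RCLike.real_smul_eq_coe_smul (K := 𝕜)]
      rw [h3, pair_smul_right, smul_comm]
      congr 1
      rw [RCLike.real_smul_eq_coe_mul]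
      congr 1
      simp [pair, Pi.single_apply]
    simp only [h2]
    rw [← Finset.smul_sum, smul_smul, hσ x hx, mul_assoc,
      mul_inv_cancel₀ (h.det_ne_zero hΩ isOpen_ball hx), mul_one]
    rfl
  -- The cofactor identity produces `det ∇G`, which cancels `|det ∇F|` up to the same `σ`; that
  -- common nonzero factor is divided out at the end.
  have hright : ∀ x ∈ Ω, |(jac F x).det| • ∑ i,
      pair (crossProduct (grad (a i) (F x)) (grad (b i) (F x))) (radialPotential g (F x))
      = σ • pair (testCurl φ x) (transportedPotential F G f x) := fun x hx => by
    have h1 : ∀ i, crossProduct (grad (a i) (F x)) (grad (b i) (F x))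
        = crossProduct ((jac G (F x)).transpose.mulVec (grad (φ i) x))
          ((jac G (F x)).transpose.mulVec (Pi.single i 1)) := fun i => by
      by_cases hs : F x ∈ tsupport (a i)
      · rw [hgrada x hx, hgradb x i hs]
      · have h0 : grad (a i) (F x) = 0 := by
          ext j
          have : fderiv ℝ (a i) (F x) = 0 := by
            by_contra h2
            exact hs (support_fderiv_subset ℝ h2)
          simp [grad, pderiv, this]
        rw [← hgrada x hx, h0]
        simp
    have hu : radialPotential g (F x)
        = actOn (jac G (F x)).transpose (transportedPotential F G f x) := by
      rw [h.transportedPotential_apply hx, ← actOn_mul, ← Matrix.transpose_mul]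
      have h3 := h.symm.jac_mul_jac isOpen_ball hΩ (h.mapsTo hx)
      rw [h.left_inv hx] at h3
      rw [h3, Matrix.transpose_one, actOn_one]
    have h2 : ∀ i, pair (crossProduct (grad (a i) (F x)) (grad (b i) (F x)))
        (radialPotential g (F x))
        = (jac G (F x)).det • pair (crossProduct (grad (φ i) x) (Pi.single i 1))
          (transportedPotential F G f x) := fun i => by
      rw [h1, hu, pair_actOn, Matrix.transpose_transpose, mulVec_cross_transpose, pair_smul_left]
    simp only [h2]
    have hpair : ∑ i, pair (crossProduct (grad (φ i) x) (Pi.single i 1))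
        (transportedPotential F G f x) = pair (testCurl φ x) (transportedPotential F G f x) := by
      rw [← sum_grad_cross_single]
      simp only [Fin.sum_univ_three, pair_add_left]
    rw [← Finset.smul_sum, hpair, smul_smul, hσ x hx, mul_assoc, mul_comm (jac F x).det,
      h.det_mul_det hΩ isOpen_ball hx, mul_one]
  rw [setIntegral_congr_fun hΩ.measurableSet hleft,
    setIntegral_congr_fun hΩ.measurableSet hright, integral_smul, integral_smul] at hsum
  exact smul_right_injective 𝕜 hσ0 hsum

end IsDiffeo

end Potential

/-! ### Linearity of the potential -/

section Linearity

variable {𝕜 : Type*} [RCLike 𝕜]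

/-- Each ray is a null set, so a null modification of `g` could a priori change radial integrals.
The weighted estimate with zero right-hand side shows that almost every `y` is unaffected. -/
theorem ae_radialAvg_eq_zero {g : E3 → V3 𝕜} (hm : StronglyMeasurable g)
    (h0 : ∀ᵐ y ∂volume.restrict (ball (0 : E3) 1), g y = 0) :
    ∀ᵐ y ∂volume.restrict (ball (0 : E3) 1), radialAvg (fun z => ‖g z‖ₑ) y = 0 := by
  have h1 := setLIntegral_radialAvg_sq_le (α := 0) le_rfl hm.enorm
  have h2 : ∫⁻ z in ball (0 : E3) 1, ENNReal.ofReal ((1 - ‖z‖) ^ (0 : ℝ)) * ‖g z‖ₑ ^ 2 = 0 := by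
    rw [← lintegral_zero (μ := volume.restrict (ball (0 : E3) 1))]
    refine lintegral_congr_ae ?_
    filter_upwards [h0] with z hz
    simp [hz]
  rw [h2, mul_zero, nonpos_iff_eq_zero,
    lintegral_eq_zero_iff ((measurable_radialAvg hm.enorm).pow_const 2)] at h1
  filter_upwards [h1] with y hy
  simpa using hy

theorem radialIntegrand_smul_add (c : 𝕜) (g₁ g₂ : E3 → V3 𝕜) {v : V3 𝕜} {y : E3} {t : ℝ}
    (h : v = c • g₁ (t • y) + g₂ (t • y)) :
    t • crossE y v = c • radialIntegrand g₁ y t + radialIntegrand g₂ y t := by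
  subst h
  ext i
  simp only [radialIntegrand, crossE_apply, PiLp.smul_apply, PiLp.add_apply,
    RCLike.real_smul_eq_coe_mul, smul_eq_mul]
  fin_cases i <;> simp <;> ring

/-- The null-set statement is applied to `g - (c g₁ + g₂)`; finiteness of the radial averages of
`g₁` and `g₂` permits splitting the integral. -/
theorem ae_radialPotential_eq {g g₁ g₂ : E3 → V3 𝕜} (hm : StronglyMeasurable g)
    (hm₁ : StronglyMeasurable g₁) (hm₂ : StronglyMeasurable g₂) (hL₁ : MemLp g₁ 2 volume)
    (hL₂ : MemLp g₂ 2 volume) (c : 𝕜)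
    (h : ∀ᵐ y ∂volume.restrict (ball (0 : E3) 1), g y = c • g₁ y + g₂ y) :
    ∀ᵐ y ∂volume.restrict (ball (0 : E3) 1),
      radialPotential g y = c • radialPotential g₁ y + radialPotential g₂ y := by
  have he := ae_radialAvg_eq_zero (g := fun y => g y - (c • g₁ y + g₂ y))
    (hm.sub ((hm₁.const_smul c).add hm₂)) (by filter_upwards [h] with y hy; simp [hy])
  filter_upwards [he, ae_radialAvg_lt_top hm₁ hL₁, ae_radialAvg_lt_top hm₂ hL₂,
    ae_restrict_mem measurableSet_ball] with y hy hy₁ hy₂ hyb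
  have hi₁ : IntervalIntegrable (fun t => c • radialIntegrand g₁ y t) volume 0 1 :=
    (intervalIntegrable_radialIntegrand hm₁ hyb hy₁).smul c
  have hi₂ := intervalIntegrable_radialIntegrand hm₂ hyb hy₂
  have hm' : Measurable fun t : ℝ =>
      ENNReal.ofReal t * ‖g (t • y) - (c • g₁ (t • y) + g₂ (t • y))‖ₑ := by
    have hs : Measurable fun t : ℝ => t • y := measurable_id.smul measurable_const
    exact measurable_id.ennreal_ofReal.mul
      ((hm.sub ((hm₁.const_smul c).add hm₂)).comp_measurable hs).enorm
  rw [radialAvg, lintegral_eq_zero_iff hm'] at hy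
  rw [radialPotential, radialPotential, radialPotential, smul_neg, ← neg_add,
    ← intervalIntegral.integral_smul, ← intervalIntegral.integral_add hi₁ hi₂]
  simp only [intervalIntegral.integral_of_le zero_le_one, integral_Ioc_eq_integral_Ioo]
  congr 1
  refine integral_congr_ae ?_
  filter_upwards [hy, ae_restrict_mem measurableSet_Ioo] with t ht ht0
  have h1 : g (t • y) - (c • g₁ (t • y) + g₂ (t • y)) = 0 := by
    simpa [ht0.1.not_ge] using ht
  exact radialIntegrand_smul_add c g₁ g₂ (sub_eq_zero.1 h1)

theorem IsDiffeo.ae_transportedPotential_eq {Ω : Set E3} {F G : E3 → E3}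
    (h : IsDiffeo Ω (ball (0 : E3) 1) F G) (hΩ : IsOpen Ω) {f f₁ f₂ : E3 → V3 𝕜}
    (hm : StronglyMeasurable f) (hm₁ : StronglyMeasurable f₁) (hm₂ : StronglyMeasurable f₂)
    (hL₁ : MemLp f₁ 2 (volume.restrict Ω)) (hL₂ : MemLp f₂ 2 (volume.restrict Ω)) (c : 𝕜)
    (hf : ∀ᵐ x ∂volume.restrict Ω, f x = c • f₁ x + f₂ x) :
    ∀ᵐ x ∂volume.restrict Ω, transportedPotential F G f x
      = c • transportedPotential F G f₁ x + transportedPotential F G f₂ x := by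
  have h1 : ∀ᵐ y ∂volume.restrict (ball (0 : E3) 1), transportedExt F G f y
      = c • transportedExt F G f₁ y + transportedExt F G f₂ y := by
    filter_upwards [h.symm.ae_comp isOpen_ball hΩ hf, ae_restrict_mem measurableSet_ball]
      with y hy hyb
    simp only [transportedExt, indicator_of_mem hyb]
    rw [← transported_smul, ← transported_add]
    simp only [transported, hy, Pi.add_apply, Pi.smul_apply]
  have h2 := ae_radialPotential_eq (h.stronglyMeasurable_transportedExt hm)
    (h.stronglyMeasurable_transportedExt hm₁) (h.stronglyMeasurable_transportedExt hm₂)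
    (h.memLp_transportedExt hΩ hm₁ hL₁) (h.memLp_transportedExt hΩ hm₂ hL₂) c h1
  filter_upwards [h.ae_comp hΩ isOpen_ball h2, ae_restrict_mem hΩ.measurableSet] with x hx hxΩ
  rw [h.transportedPotential_apply hxΩ, h.transportedPotential_apply hxΩ,
    h.transportedPotential_apply hxΩ, hx, actOn_add, actOn_smul]

theorem IsDiffeo.ae_intervalIntegrable {Ω : Set E3} {F G : E3 → E3}
    (h : IsDiffeo Ω (ball (0 : E3) 1) F G) (hΩ : IsOpen Ω) {f : E3 → V3 𝕜}
    (hm : StronglyMeasurable f) (hL : MemLp f 2 (volume.restrict Ω)) :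
    ∀ᵐ x ∂volume.restrict Ω,
      IntervalIntegrable (radialIntegrand (transported F G f) (F x)) volume 0 1 := by
  have h1 : ∀ᵐ y ∂volume.restrict (ball (0 : E3) 1),
      IntervalIntegrable (radialIntegrand (transported F G f) y) volume 0 1 := by
    have hgm := h.stronglyMeasurable_transportedExt hm
    filter_upwards [ae_radialAvg_lt_top hgm (h.memLp_transportedExt hΩ hm hL),
      ae_restrict_mem measurableSet_ball] with y hy hyb
    refine (intervalIntegrable_radialIntegrand hgm hyb hy).congr fun t ht => ?_
    rw [uIoc_of_le zero_le_one] at ht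
    exact radialIntegrand_transportedExt hyb (Ioc_subset_Icc_self ht)
  exact h.ae_comp hΩ isOpen_ball h1

/-! ### From pointwise representatives to `L²` classes and real-valued integrals -/

theorem IsWeakCurl.congr_ae {Ω : Set E3} {u u' w : E3 → V3 𝕜} (h : IsWeakCurl Ω u w)
    (hu : u =ᵐ[volume.restrict Ω] u') : IsWeakCurl Ω u' w := by
  intro φ hφ
  rw [h φ hφ]
  refine integral_congr_ae ?_
  filter_upwards [hu] with x hx
  rw [hx]

theorem setIntegral_norm_sq_le_of_lintegral {Ω : Set E3} {u v : E3 → V3 𝕜} {w : E3 → ℝ}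
    (hw : ∀ x, 0 ≤ w x) (hu : MemLp u 2 (volume.restrict Ω))
    (hwv : IntegrableOn (fun x => w x * ‖v x‖ ^ 2) Ω) {C : ℝ} (hC : 0 ≤ C)
    (h : ∫⁻ x in Ω, ‖u x‖ₑ ^ 2
      ≤ ENNReal.ofReal C * ∫⁻ x in Ω, ENNReal.ofReal (w x) * ‖v x‖ₑ ^ 2) :
    ∫ x in Ω, ‖u x‖ ^ 2 ≤ C * ∫ x in Ω, w x * ‖v x‖ ^ 2 := by
  have hnn : 0 ≤ ∫ x in Ω, w x * ‖v x‖ ^ 2 :=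
    integral_nonneg fun x => mul_nonneg (hw x) (sq_nonneg _)
  rw [← ENNReal.ofReal_le_ofReal_iff (mul_nonneg hC hnn), ENNReal.ofReal_mul hC,
    ofReal_integral_eq_lintegral_ofReal (hu.integrable_norm_pow two_ne_zero)
      (.of_forall fun x => sq_nonneg _),
    ofReal_integral_eq_lintegral_ofReal hwv
      (.of_forall fun x => mul_nonneg (hw x) (sq_nonneg _))]
  simpa only [ENNReal.ofReal_mul (hw _), ENNReal.ofReal_pow (norm_nonneg _), ofReal_norm] using h

end Linearity

theorem mainTheorem8 (𝕜 : Type*) [RCLike 𝕜] (α : ℝ) (hα₀ : 0 ≤ α) (hα₂ : α < 2)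
    (Ω : Set E3) (hΩ : IsOpen Ω) (F G : E3 → E3)
    (hFG : IsDiffeo Ω (Metric.ball (0 : E3) 1) F G) :
    ∃ T₁ : HdivFree 𝕜 Ω →ₗ[𝕜] Hcurl 𝕜 Ω,
      (∀ f : HdivFree 𝕜 Ω,
        IsWeakCurl Ω ((T₁ f : L2Field 𝕜 Ω) : E3 → V3 𝕜) ((f : L2Field 𝕜 Ω) : E3 → V3 𝕜)) ∧
      (∃ C : ℝ, 0 < C ∧ ∀ f : HdivFree 𝕜 Ω,
        ∫ x in Ω, ‖(T₁ f : L2Field 𝕜 Ω) x‖ ^ 2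
          ≤ C * ∫ x in Ω, Metric.infDist x (frontier Ω) ^ α * ‖(f : L2Field 𝕜 Ω) x‖ ^ 2) ∧
      (∀ f : HdivFree 𝕜 Ω, ∀ᵐ x ∂(volume.restrict Ω),
        IntervalIntegrable
            (radialIntegrand (transported F G ((f : L2Field 𝕜 Ω) : E3 → V3 𝕜)) (F x))
            volume 0 1 ∧
          (T₁ f : L2Field 𝕜 Ω) x
            = actOn (jac F x).transpose
                (radialPotential (transported F G ((f : L2Field 𝕜 Ω) : E3 → V3 𝕜)) (F x))) := by
  have hb : Bornology.IsBounded Ω := by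
    rw [← hFG.symm.image_eq]
    exact hFG.regular_inv.isBounded_image isBounded_ball
  have hfin : IsFiniteMeasure (volume.restrict Ω) := ⟨by simpa using hb.measure_lt_top⟩
  have hm : ∀ f : L2Field 𝕜 Ω, StronglyMeasurable f := fun f => Lp.stronglyMeasurable f
  have hL : ∀ f : L2Field 𝕜 Ω, MemLp f 2 (volume.restrict Ω) := fun f => Lp.memLp f
  have hu : ∀ f : L2Field 𝕜 Ω, MemLp (transportedPotential F G f) 2 (volume.restrict Ω) :=
    fun f => hFG.memLp_transportedPotential hΩ (hm f) (hL f)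
  have hcurl : ∀ f : HdivFree 𝕜 Ω, IsWeakCurl Ω
      ((hu (f : L2Field 𝕜 Ω)).toLp _ : L2Field 𝕜 Ω) ((f : L2Field 𝕜 Ω) : E3 → V3 𝕜) := fun f =>
    (hFG.isWeakCurl_transportedPotential hΩ (hm _) (hL _) ((hL _).integrable (by norm_num))
      f.2.2).congr_ae (hu _).coeFn_toLp.symm
  -- Additivity is the case `c = 1`, and homogeneity the case `f₂ = 0` once the image of `0` is
  -- known to be `0`.
  have hlin : ∀ (c : 𝕜) (f f₁ f₂ : L2Field 𝕜 Ω), f = c • f₁ + f₂ →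
      (hu f).toLp _ = c • (hu f₁).toLp _ + (hu f₂).toLp _ := by
    intro c f f₁ f₂ hf
    have h1 : ∀ᵐ x ∂volume.restrict Ω, f x = c • f₁ x + f₂ x := by
      subst hf
      filter_upwards [Lp.coeFn_add (c • f₁) f₂, Lp.coeFn_smul c f₁] with x hx hx'
      rw [hx, Pi.add_apply, hx', Pi.smul_apply]
    have h2 := hFG.ae_transportedPotential_eq hΩ (hm f) (hm f₁) (hm f₂) (hL f₁) (hL f₂) c h1
    rw [← MemLp.toLp_const_smul, ← MemLp.toLp_add]
    exact (MemLp.toLp_eq_toLp_iff _ _).2 h2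
  have hzero : (hu 0).toLp _ = (0 : L2Field 𝕜 Ω) := by
    have := hlin 1 0 0 0 (by simp)
    rwa [one_smul, left_eq_add] at this
  let T₁ : HdivFree 𝕜 Ω →ₗ[𝕜] Hcurl 𝕜 Ω :=
    { toFun := fun f => ⟨(hu (f : L2Field 𝕜 Ω)).toLp _, ⟨f, hcurl f⟩⟩
      map_add' := fun f g => Subtype.ext <| by
        simpa using hlin 1 ((f : L2Field 𝕜 Ω) + g) f g (by rw [one_smul])
      map_smul' := fun c f => Subtype.ext <| by
        have := hlin c (c • (f : L2Field 𝕜 Ω)) f 0 (by rw [add_zero])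
        rw [hzero, add_zero] at this
        exact this }
  have hT : ∀ f : HdivFree 𝕜 Ω, (T₁ f : L2Field 𝕜 Ω)
      =ᵐ[volume.restrict Ω] transportedPotential F G ((f : L2Field 𝕜 Ω) : E3 → V3 𝕜) :=
    fun f => (hu (f : L2Field 𝕜 Ω)).coeFn_toLp
  refine ⟨T₁, hcurl, ?_, fun f => ?_⟩
  · obtain ⟨C, hC0, hC⟩ :=
      hFG.exists_lintegral_transportedPotential_le (𝕜 := 𝕜) hΩ hα₀ hα₂
    refine ⟨C, hC0, fun f => ?_⟩
    have hc : Continuous fun x : E3 => infDist x (frontier Ω) ^ α :=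
      (continuous_infDist_pt _).rpow_const fun _ => Or.inr hα₀
    -- Boundedness of the weight on `Ω` makes the right-hand integrand integrable, so its Bochner
    -- integral is the true value and not the default `0`.
    obtain ⟨R, hR⟩ := hb.isCompact_closure.exists_bound_of_continuousOn hc.continuousOn
    refine setIntegral_norm_sq_le_of_lintegral (fun x => Real.rpow_nonneg infDist_nonneg α)
      (hL _) ?_ hC0.le ?_
    · refine ((hL (f : L2Field 𝕜 Ω)).integrable_norm_pow two_ne_zero).bdd_mul (c := R)
        hc.aestronglyMeasurable ?_
      filter_upwards [ae_restrict_mem hΩ.measurableSet] with x hx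
        using hR x (subset_closure hx)
    · refine (lintegral_congr_ae ?_).trans_le (hC f (hm f))
      filter_upwards [hT f] with x hx
      rw [hx]
  · filter_upwards [hFG.ae_intervalIntegrable hΩ (hm f) (hL f), hT f] with x hx hx'
    exact ⟨hx, hx'⟩
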